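/- Let $\Sigma$ be a finite set, $\mathcal R$ a reflexive and symmetric relation on $\Sigma$, and let $\mathcal M=\langle\Sigma\mid ab=ba \text{ for }(a,b)\notin\mathcal R\rangle$ be the trace monoid. For $S\subseteq\Sigma$ let $\mathcal M_S$ be the submonoid generated by $S$. For $x\in\mathcal M$ let $|x|$ be its length and $|x|_a$ the number of occurrences of $a\in\Sigma$ in $x$. The heap of $x$ is the following labelled partial order: choose a word $w_1\cdots w_n$ representing $x$, take the pieces $1,\dots,n$ with labels $w_1,\dots,w_n$, and the order generated by $i\le j$ whenever $i<j$ and $(w_i,w_j)\in\mathcal R$; up to isomorphism it depends only on $x$. Write $\max(x)\subseteq U$ if all the maximal pieces of the heap of $x$ have their label in $U$. Let $\mathrm{Lk}(a)=\{b:(a,b)\in\mathcal R\}$. A trace is $a$-pyramidal if it is the trace of the sub-heap of all pieces below or equal to the lowest piece labelled $a$, in the heap of some $x$ with $|x|_a>0$. Let $\mu_S(X)=\sum_\gamma(-1)^{|\gamma|}X^{|\gamma|}$, where $\gamma$ ranges over the subsets of $S$ whose distinct elements are pairwise not related by $\mathcal R$. Let $p_S$ be the root of smallest modulus of $\mu_S$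 (it is real and positive) if $S\ne\emptyset$, and let $p_\emptyset=+\infty$. For $0<p<p_S$ let $B_{S,p}$ be the probability distribution on $\mathcal M_S$ given by $B_{S,p}(\{x\})=\mu_S(p)\,p^{|x|}$. Let $T\subseteq\Sigma$, $a_1\in T$, $p\in(0,p_\Sigma)$, $\Sigma'=\Sigma\setminus\{a_1\}$ and $r=1-\mu_\Sigma(p)/\mu_{\Sigma'}(p)$. Then $p<p_{\Sigma'}$, so that $B_{\Sigma',p}$ is a well-defined probability distribution; $r\in(0,1)$; and $r=B_{\Sigma,p}(|\xi|_{a_1}>0)$. Every $x\in\mathcal M$ can be written in a unique way as $x=u_0\cdots u_k$ with $k=|x|_{a_1}$, with $u_0,\dots,u_{k-1}$ being $a_1$-pyramidal and $u_k\in\mathcal M_{\Sigma'}$; and every $a_1$-pyramidal $u$ is $u=v\cdot a_1$ for a unique $v\in\mathcal M_{\Sigma'}$. Moreover: (1) Let $\xi$ be a random element of $\mathcal M$ distributed according to $B_{\Sigma,p}$ conditioned on $\{\max(\xi)\subseteq T\}$. Let $K=|\xi|_{a_1}$, let $\xi=U_0\cdots U_K$ be the above decomposition of $\xi$, and let $U_i=V_i\cdot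 a_1$ with $V_i\in\mathcal M_{\Sigma'}$ for $i<K$. Then $\mathbb P(K=k)=(1-r)r^k$ for every integer $k\ge0$. For every $k\geq 0$, conditionally on $\{K=k\}$: the variables $U_0,\dots,U_k$ are independent; $U_0,\dots,U_{k-1}$ are identically distributed; each of $V_0,\dots,V_{k-1}$ has the law $B_{\Sigma',p}$ conditioned on $\{\max(\cdot)\subseteq\mathrm{Lk}(a_1)\}$; and $U_k$ has the law $B_{\Sigma',p}$ conditioned on $\{\max(\cdot)\subseteq T\}$. (2) Conversely, let $K$ be a random integer with $\mathbb P(K=k)=(1-r)r^k$ for every $k\ge0$, and suppose that for every $k\ge0$, conditionally on $\{K=k\}$, the variables $V_0,\dots,V_{k-1},U$ are independent, each $V_i$ has the law $B_{\Sigma',p}$ conditioned on $\{\max(\cdot)\subseteq\mathrm{Lk}(a_1)\}$, and $U$ has the law $B_{\Sigma',p}$ conditioned on $\{\max(\cdot)\subseteq T\}$. Then $\xi=(V_0\cdot a_1)\cdots(V_{K-1}\cdot a_1)\cdot U$ is distributed according to $B_{\Sigma,p}$ conditioned on $\{\max(\xi)\subseteq T\}$. -/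

import Mathlib

open MeasureTheory ProbabilityTheory
open scoped ENNReal

noncomputable section

/-- The defining relations `ab = ba` for `(a, b) ∉ R`. -/
inductive CommRel {α : Type*} (R : α → α → Prop) : FreeMonoid α → FreeMonoid α → Prop
  | swap (a b : α) (h : ¬ R a b) :
      CommRel R (FreeMonoid.of a * FreeMonoid.of b) (FreeMonoid.of b * FreeMonoid.of a)

/-- The trace monoid `⟨α | ab = ba for (a, b) ∉ R⟩`. -/
def TraceMonoid {α : Type*} (R : α → α → Prop) : Type _ := PresentedMonoid (CommRel R)

namespace TraceMonoid

variable {α : Type*} (R : α → α → Prop)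

instance : Monoid (TraceMonoid R) := inferInstanceAs (Monoid (PresentedMonoid (CommRel R)))

/-- Traces form a discrete space. -/
instance : MeasurableSpace (TraceMonoid R) := ⊤

/-- The class of a word. -/
def ofWord (w : List α) : TraceMonoid R :=
  PresentedMonoid.mk (CommRel R) (FreeMonoid.ofList w)

/-- A letter, as a trace. -/
def letter (a : α) : TraceMonoid R := ofWord R [a]

/-- The multiset of the letters of a trace. -/
def letters : TraceMonoid R →* Multiplicative (Multiset α) :=
  PresentedMonoid.lift (rels := CommRel R) (fun a => Multiplicative.ofAdd {a}) (by
    rintro _ _ ⟨a, b, _⟩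
    simp only [map_mul, FreeMonoid.lift_eval_of]
    exact mul_comm _ _)

/-- The length `|x|` of a trace. -/
def length (x : TraceMonoid R) : ℕ := Multiset.card (Multiplicative.toAdd (letters R x))

open Classical in
/-- The number `|x|_a` of occurrences of the letter `a` in a trace. -/
def occ (a : α) (x : TraceMonoid R) : ℕ :=
  Multiset.count a (Multiplicative.toAdd (letters R x))

/-- The submonoid generated by a set of letters. -/
def sub (S : Set α) : Submonoid (TraceMonoid R) := Submonoid.closure (letter R '' S)

/-- The order of the heap of a word: the pieces are the positions of the word, labelled by the
letters there, and the order is generated by `i ≤ j` whenever `i < j` and the labels of `i` and `j`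
are related by `R`. -/
def HeapLE (w : List α) : Fin w.length → Fin w.length → Prop :=
  Relation.ReflTransGen fun i j => i < j ∧ R (w.get i) (w.get j)

/-- `max(x) ⊆ U`: all the maximal pieces of the heap of `x` have their label in `U`. (All the words
that represent `x` have isomorphic heaps.) -/
def MaxIn (U : Set α) (x : TraceMonoid R) : Prop :=
  ∀ w : List α, ofWord R w = x →
    ∀ i : Fin w.length, (∀ j, HeapLE R w i j → j = i) → w.get i ∈ U

/-- The link of a letter. -/
def link (a : α) : Set α := {b | R a b}

open Classical in
/-- The trace of the sub-heap of the pieces that are below the piece `i`. -/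
def below (w : List α) (i : Fin w.length) : TraceMonoid R :=
  ofWord R (((List.finRange w.length).filter fun j => HeapLE R w j i).map w.get)

/-- The `a`-pyramidal traces: those obtained from a trace (represented by a word `w`) in which `a`
occurs, as the sub-heap of the pieces below the first (lowest) piece `i` labelled `a`. -/
def pyr (a : α) : Set (TraceMonoid R) :=
  {y | ∃ (w : List α) (i : Fin w.length),
    w.get i = a ∧ (∀ j < i, w.get j ≠ a) ∧ y = below R w i}

/-- `x = u₀ ⋯ u_k` with `u₀, …, u_{k-1}` being `a`-pyramidal and `u_k` without the letter `a`. -/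
structure IsPyrDecomp (a : α) (x : TraceMonoid R) (k : ℕ) (u : Fin (k + 1) → TraceMonoid R) :
    Prop where
  pyramidal : ∀ i : Fin k, u i.castSucc ∈ pyr R a
  remainder : u (Fin.last k) ∈ sub R {a}ᶜ
  prod_eq : (List.ofFn u).prod = x

variable [Fintype α]

open Classical in
/-- The Möbius polynomial of the trace monoid on a set `S` of letters: the sum of
`(-1)^|γ| X^|γ|` over the cliques, i.e. the sets `γ ⊆ S` of pairwise commuting letters. -/
def mobius (S : Set α) : Polynomial ℤ :=
  ∑ γ ∈ Finset.univ.filter fun γ : Finset α =>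
      (∀ a ∈ γ, a ∈ S) ∧ ∀ a ∈ γ, ∀ b ∈ γ, a ≠ b → ¬ R a b,
    (-1) ^ γ.card * Polynomial.X ^ γ.card

/-- The value `μ_S(p)` of the Möbius polynomial. -/
def mobiusAt (S : Set α) (p : ℝ) : ℝ := Polynomial.aeval p (mobius R S)

/-- The root `p_S` of smallest modulus of the Möbius polynomial, given as the smallest modulus of a
complex root; it is `⊤` if `S = ∅`, where the polynomial is `1`. -/
def smallestRoot (S : Set α) : ℝ≥0∞ :=
  ⨅ (z : ℂ) (_ : Polynomial.aeval z (mobius R S) = 0), ‖z‖ₑ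

/-- The multiplicative probability `B_{S,p}`, which gives mass `μ_S(p) p^|x|` to each trace `x` on
the letters of `S`, as a measure on the whole trace monoid. -/
def multMeasure (S : Set α) (p : ℝ) : Measure (TraceMonoid R) :=
  Measure.sum fun x : sub R S =>
    ENNReal.ofReal (mobiusAt R S p * p ^ length R (x : TraceMonoid R)) •
      Measure.dirac (x : TraceMonoid R)

/-- `B_{S,p}` conditioned on `max(·) ⊆ T`. -/
def condMeasure (S : Set α) (p : ℝ) (T : Set α) : Measure (TraceMonoid R) :=
  (multMeasure R S p)[|{x | MaxIn R T x}]

end TraceMonoid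

end

/-!
Traces embed, through their projections to pairs of related letters, into a product of free
monoids; hence they are cancellative and satisfy Levi's lemma. It follows that the pyramidal traces
form a prefix code, so that a trace with `k` occurrences of `a` has a unique factorization into `k`
pyramidal traces and a remainder without `a`, and that its maximal letters are in `T ∋ a` if and
only if those of the remainder are.

The weight `p ^ |x|` is multiplicative. Concatenation therefore carries the product of the
conditioned weights on the pyramidal traces and on the remainders to the weight conditioned on
`max(x) ⊆ T` and `|x|_a = k`, and the mass of the latter event is that of the remainders times
`r ^ k`, where `r` is the mass of the pyramidal traces. Summing over `k` gives the geometric law,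
and its total mass identifies `r`, since the Möbius inversion `μ_S · ∑ X ^ |x| = 1` and the radius
of convergence of the series show that the weight of `sub R S` at `p < p_S` is `μ_S(p)⁻¹`.
-/

section PowerSeries

open scoped Topology NNReal

section NormedCommRing

variable {𝕜 : Type*} [NormedCommRing 𝕜]

theorem hasSum_coeff_one_mul_pow (z : 𝕜) :
    HasSum (fun n => (1 : PowerSeries 𝕜).coeff n * z ^ n) 1 := by
  convert hasSum_ite_eq (0 : ℕ) (1 : 𝕜) using 2 with n
  rw [PowerSeries.coeff_one]
  split_ifs with hn <;> simp [hn]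

variable [CompleteSpace 𝕜]

theorem hasSum_coeff_mul_mul_pow {φ ψ : PowerSeries 𝕜} {z : 𝕜}
    (hφ : Summable fun n => ‖φ.coeff n * z ^ n‖) (hψ : Summable fun n => ‖ψ.coeff n * z ^ n‖) :
    HasSum (fun n => (φ * ψ).coeff n * z ^ n)
      ((∑' n, φ.coeff n * z ^ n) * ∑' n, ψ.coeff n * z ^ n) := by
  have hcauchy : ∀ n, (φ * ψ).coeff n * z ^ n = ∑ kl ∈ Finset.HasAntidiagonal.antidiagonal n,
      φ.coeff kl.1 * z ^ kl.1 * (ψ.coeff kl.2 * z ^ kl.2) := fun n => by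
    rw [PowerSeries.coeff_mul, Finset.sum_mul]
    refine Finset.sum_congr rfl fun kl hkl => ?_
    rw [← Finset.HasAntidiagonal.mem_antidiagonal.1 hkl, pow_add, mul_mul_mul_comm]
  simp only [hcauchy]
  rw [tsum_mul_tsum_eq_tsum_sum_antidiagonal_of_summable_norm hφ hψ]
  exact (summable_norm_sum_mul_antidiagonal_of_summable_norm hφ hψ).of_norm.hasSum

theorem hasSum_coeff_coe_mul_mul_pow (P : Polynomial 𝕜) {φ : PowerSeries 𝕜} {z : 𝕜}
    (hφ : Summable fun n => ‖φ.coeff n * z ^ n‖) :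
    HasSum (fun n => (P * φ : PowerSeries 𝕜).coeff n * z ^ n)
      (P.eval z * ∑' n, φ.coeff n * z ^ n) := by
  have hzero : ∀ n ∉ P.support, (P : PowerSeries 𝕜).coeff n * z ^ n = 0 := fun n hn => by
    rw [Polynomial.coeff_coe, Polynomial.notMem_support_iff.1 hn, zero_mul]
  have heval : P.eval z = ∑' n, (P : PowerSeries 𝕜).coeff n * z ^ n := by
    rw [tsum_eq_sum hzero, Polynomial.eval_eq_sum, Polynomial.sum]
    simp only [Polynomial.coeff_coe]
  rw [heval]
  exact hasSum_coeff_mul_mul_pow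
    (summable_of_ne_finset_zero fun n hn => by rw [hzero n hn, norm_zero]) hφ

theorem eval_mul_tsum_eq_one_of_mul_eq_one {P : Polynomial 𝕜} {φ : PowerSeries 𝕜}
    (h : (P : PowerSeries 𝕜) * φ = 1) {z : 𝕜} (hφ : Summable fun n => ‖φ.coeff n * z ^ n‖) :
    P.eval z * ∑' n, φ.coeff n * z ^ n = 1 :=
  (h ▸ hasSum_coeff_coe_mul_mul_pow P hφ).unique (hasSum_coeff_one_mul_pow z)

end NormedCommRing

theorem eq_of_eventually_hasSum_coeff_mul_pow {𝕜 : Type*} [NontriviallyNormedField 𝕜]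
    {f : 𝕜 → 𝕜} {φ ψ : PowerSeries 𝕜}
    (hφ : ∀ᶠ z in 𝓝 0, HasSum (fun n => φ.coeff n * z ^ n) (f z))
    (hψ : ∀ᶠ z in 𝓝 0, HasSum (fun n => ψ.coeff n * z ^ n) (f z)) : φ = ψ := by
  have hasFPowerSeriesAt : ∀ χ : PowerSeries 𝕜,
      (∀ᶠ z in 𝓝 0, HasSum (fun n => χ.coeff n * z ^ n) (f z)) →
        HasFPowerSeriesAt f (.ofScalars 𝕜 fun n => χ.coeff n) 0 := fun χ hχ => by
    rw [hasFPowerSeriesAt_iff]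
    filter_upwards [hχ] with z hz
    simpa [FormalMultilinearSeries.coeff_ofScalars, mul_comm] using hz
  have := (hasFPowerSeriesAt φ hφ).eq_formalMultilinearSeries (hasFPowerSeriesAt ψ hψ)
  ext n
  simpa [FormalMultilinearSeries.coeff_ofScalars] using
    congrArg (FormalMultilinearSeries.coeff · n) this

/-- `φ` is the Taylor series of the reciprocal of `P`, which is holomorphic on the ball. -/
theorem summable_norm_coeff_mul_pow_of_mul_eq_one {P : Polynomial ℂ} {φ : PowerSeries ℂ}
    (h : (P : PowerSeries ℂ) * φ = 1) {s r : ℝ≥0} (hsr : s < r)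
    (hP : ∀ z ∈ Metric.closedBall (0 : ℂ) r, P.eval z ≠ 0) :
    Summable fun n => ‖φ.coeff n‖ * (s : ℝ) ^ n := by
  have hdiff : DifferentiableOn ℂ (fun z => (P.eval z)⁻¹) (Metric.closedBall 0 r) :=
    P.differentiable.differentiableOn.inv hP
  have hinv := hdiff.hasFPowerSeriesOnBall (pos_of_gt hsr)
  set c := cauchyPowerSeries (fun z => (P.eval z)⁻¹) 0 r
  let ψ : PowerSeries ℂ := .mk c.coeff
  have hsummable : ∀ t : ℝ≥0, t < r → Summable fun n => ‖ψ.coeff n‖ * (t : ℝ) ^ n := fun t ht => by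
    simpa [ψ] using c.summable_norm_mul_pow ((ENNReal.coe_lt_coe.2 ht).trans_le hinv.r_le)
  have hPψ : (P : PowerSeries ℂ) * ψ = 1 := by
    refine eq_of_eventually_hasSum_coeff_mul_pow (f := 1) ?_
      (.of_forall hasSum_coeff_one_mul_pow)
    filter_upwards [Metric.ball_mem_nhds (0 : ℂ) (NNReal.coe_pos.2 (pos_of_gt hsr))] with z hz
    have hsum : HasSum (fun n => ψ.coeff n * z ^ n) (P.eval z)⁻¹ := by
      simpa [ψ, mul_comm] using hinv.hasSum (y := z) (by simpa using hz)
    have := hasSum_coeff_coe_mul_mul_pow P (φ := ψ) (z := z) (by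
      simpa using hsummable ‖z‖₊ (mem_ball_zero_iff.1 hz))
    rwa [hsum.tsum_eq, mul_inv_cancel₀ (hP z (Metric.ball_subset_closedBall hz))] at this
  rw [show φ = ψ from left_inv_eq_right_inv ((mul_comm _ _).trans h) hPψ]
  exact hsummable s hsr

end PowerSeries

section Conditioning

variable {Ω 𝓧 𝓨 : Type*} [MeasurableSpace Ω] [MeasurableSpace 𝓧] [MeasurableSpace 𝓨]

theorem sum_smul_cond_fiber {ι : Type*} [Countable ι] [MeasurableSpace ι]
    [MeasurableSingletonClass ι] {K : Ω → ι} (hK : Measurable K) (P : Measure Ω)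
    [IsFiniteMeasure P] :
    Measure.sum (fun k => P {ω | K ω = k} • P[|{ω | K ω = k}]) = P := by
  have hmeas : ∀ k, MeasurableSet {ω | K ω = k} := fun k => hK (measurableSet_singleton k)
  have hdisj : Pairwise (Function.onFun Disjoint fun k => {ω | K ω = k}) := fun k l hkl =>
    Set.disjoint_left.2 fun ω hk hl => hkl (hk.symm.trans hl)
  have hcond : ∀ k, P {ω | K ω = k} • P[|{ω | K ω = k}] = P.restrict {ω | K ω = k} := fun k => by
    ext s hs
    rw [Measure.smul_apply, smul_eq_mul, mul_comm, cond_mul_eq_inter (hmeas k),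
      Measure.restrict_apply hs, Set.inter_comm]
  simp only [hcond]
  rw [← Measure.restrict_iUnion hdisj hmeas, Set.iUnion_eq_univ_iff.2 fun ω => ⟨K ω, rfl⟩,
    Measure.restrict_univ]

theorem hasLaw_cond_preimage {X : Ω → 𝓧} {μ : Measure 𝓧} {P : Measure Ω} (hX : Measurable X)
    (h : HasLaw X μ P) {s : Set 𝓧} (hs : MeasurableSet s) : HasLaw X μ[|s] P[|X ⁻¹' s] where
  aemeasurable := hX.aemeasurable
  map_eq := by
    rw [ProbabilityTheory.cond, ProbabilityTheory.cond, Measure.map_smul,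
      ← Measure.restrict_map hX hs, ← h.map_eq, Measure.map_apply hX hs]

theorem hasLaw_of_hasLaw_cond_fiber {ι : Type*} [Countable ι] [MeasurableSpace ι]
    [MeasurableSingletonClass ι] {X : Ω → 𝓧} {μ : Measure 𝓧} {P : Measure Ω} [IsFiniteMeasure μ]
    [IsFiniteMeasure P] {K : Ω → ι} {N : 𝓧 → ι} (hK : Measurable K) (hN : Measurable N)
    (hKN : ∀ k, P {ω | K ω = k} = μ {x | N x = k})
    (hX : ∀ k, HasLaw X μ[|{x | N x = k}] P[|{ω | K ω = k}]) : HasLaw X μ P := by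
  have hmeas : AEMeasurable X (Measure.sum fun k => P {ω | K ω = k} • P[|{ω | K ω = k}]) :=
    aemeasurable_sum_measure_iff.2 fun k => (hX k).aemeasurable.smul_measure _
  refine ⟨sum_smul_cond_fiber hK P ▸ hmeas, ?_⟩
  rw [← sum_smul_cond_fiber hK P, Measure.map_sum hmeas, ← sum_smul_cond_fiber hN μ]
  simp only [Measure.map_smul, (hX _).map_eq, hKN]

theorem hasLaw_of_hasLaw_comp_of_injOn [Nonempty 𝓧] [DiscreteMeasurableSpace 𝓧]
    [DiscreteMeasurableSpace 𝓨] {X : Ω → 𝓧} {μ : Measure 𝓧} {P : Measure Ω} {f : 𝓧 → 𝓨}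
    {s : Set 𝓧} (hf : Set.InjOn f s) (hμ : ∀ᵐ x ∂μ, x ∈ s) (hX : ∀ᵐ ω ∂P, X ω ∈ s)
    (h : HasLaw (f ∘ X) (μ.map f) P) : HasLaw X μ P := by
  have hinv : HasLaw (Function.invFunOn f s) μ (μ.map f) := by
    refine ⟨Measurable.of_discrete.aemeasurable, ?_⟩
    rw [Measure.map_map .of_discrete .of_discrete]
    exact (Measure.map_congr (hμ.mono fun x hx => hf.leftInvOn_invFunOn hx)).trans Measure.map_id
  exact (hinv.comp h).congr (hX.mono fun ω hω => (hf.leftInvOn_invFunOn hω).symm)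

theorem cond_pi_pi {ι : Type*} [Fintype ι] {𝓧 : ι → Type*} [∀ i, MeasurableSpace (𝓧 i)]
    (μ : ∀ i, Measure (𝓧 i)) [∀ i, SigmaFinite (μ i)] {s : ∀ i, Set (𝓧 i)}
    (h0 : ∀ i, μ i (s i) ≠ 0) (htop : ∀ i, μ i (s i) ≠ ∞) :
    (Measure.pi μ)[|Set.univ.pi s] = Measure.pi fun i => (μ i)[|s i] := by
  have := fun i => cond_isProbabilityMeasure_of_finite (h0 i) (htop i)
  refine (Measure.pi_eq fun t _ => ?_).symm
  rw [ProbabilityTheory.cond, Measure.restrict_pi_pi, Measure.smul_apply, Measure.pi_pi,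
    Measure.pi_pi, ENNReal.prod_inv_distrib fun i _ j _ _ => .inl (h0 i), smul_eq_mul,
    ← Finset.prod_mul_distrib]
  rfl

section Image

variable [DiscreteMeasurableSpace 𝓧] [Countable 𝓨] [DiscreteMeasurableSpace 𝓨]
  {μ : Measure 𝓧} {ν : Measure 𝓨} {f : 𝓧 → 𝓨} {s : Set 𝓧} {c : ℝ≥0∞}

theorem restrict_image_eq_smul_map (hf : Set.InjOn f s) (h : ∀ x ∈ s, ν {f x} = c * μ {x}) :
    ν.restrict (f '' s) = c • (μ.restrict s).map f := by
  refine Measure.ext_of_singleton fun y => ?_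
  rw [Measure.restrict_apply .of_discrete, Measure.smul_apply, smul_eq_mul,
    Measure.map_apply .of_discrete .of_discrete, Measure.restrict_apply .of_discrete]
  by_cases hy : y ∈ f '' s
  · obtain ⟨x, hx, rfl⟩ := hy
    have hpre : f ⁻¹' {f x} ∩ s = {x} := Set.eq_singleton_iff_unique_mem.2
      ⟨⟨rfl, hx⟩, fun z hz => hf hz.2 hx hz.1⟩
    rw [hpre, Set.inter_eq_left.2 (Set.singleton_subset_iff.2 (Set.mem_image_of_mem f hx)), h x hx]
  · have hpre : f ⁻¹' {y} ∩ s = ∅ := Set.eq_empty_of_forall_notMem fun x hx => hy ⟨x, hx.2, hx.1⟩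
    rw [hpre, Set.singleton_inter_eq_empty.2 hy, measure_empty, measure_empty, mul_zero]

theorem measure_image_eq_mul (hf : Set.InjOn f s) (h : ∀ x ∈ s, ν {f x} = c * μ {x}) :
    ν (f '' s) = c * μ s := by
  rw [← Measure.restrict_apply_univ, restrict_image_eq_smul_map hf h, Measure.smul_apply,
    Measure.map_apply .of_discrete .univ, Set.preimage_univ, Measure.restrict_apply_univ,
    smul_eq_mul]

theorem cond_image_eq_map (hf : Set.InjOn f s) (h : ∀ x ∈ s, ν {f x} = c * μ {x}) (hc : c ≠ 0)
    (hc' : c ≠ ∞) : ν[|f '' s] = (μ[|s]).map f := by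
  rw [ProbabilityTheory.cond, restrict_image_eq_smul_map hf h, measure_image_eq_mul hf h,
    ProbabilityTheory.cond, Measure.map_smul, smul_smul, ENNReal.mul_inv (.inl hc) (.inl hc'),
    mul_right_comm, ENNReal.inv_mul_cancel hc hc', one_mul]

end Image

end Conditioning

namespace TraceMonoid

section Words

variable {α : Type*} {R : α → α → Prop}

theorem ofWord_nil : ofWord R [] = 1 := rfl

theorem ofWord_cons (c : α) (w : List α) : ofWord R (c :: w) = letter R c * ofWord R w := rfl

theorem ofWord_surjective : Function.Surjective (ofWord R) := PresentedMonoid.surjective_mk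

theorem letter_mul_comm {b c : α} (h : ¬R b c) :
    letter R b * letter R c = letter R c * letter R b :=
  PresentedMonoid.mk_eq_mk_of_rel (.swap b c h)

@[elab_as_elim]
theorem induction_on {motive : TraceMonoid R → Prop} (x : TraceMonoid R) (one : motive 1)
    (letter_mul : ∀ c x, motive x → motive (letter R c * x)) : motive x := by
  obtain ⟨w, rfl⟩ := ofWord_surjective x
  induction w with
  | nil => exact one
  | cons c w ih => exact letter_mul c _ ih

theorem letters_ofWord (w : List α) : letters R (ofWord R w) = .ofAdd (w : Multiset α) := by
  induction w with
  | nil => rfl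
  | cons c w ih =>
    rw [ofWord_cons, map_mul, ih]
    rfl

theorem length_ofWord (w : List α) : length R (ofWord R w) = w.length := by
  simp [length, letters_ofWord]

theorem length_one : length R 1 = 0 := length_ofWord []

theorem length_letter (c : α) : length R (letter R c) = 1 := length_ofWord [c]

theorem length_mul (x y : TraceMonoid R) : length R (x * y) = length R x + length R y := by
  simp [length]

theorem length_eq_zero_iff {x : TraceMonoid R} : length R x = 0 ↔ x = 1 := by
  refine ⟨fun h => ?_, fun h => h ▸ length_one⟩
  obtain ⟨w, rfl⟩ := ofWord_surjective x
  rw [length_ofWord, List.length_eq_zero_iff] at h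
  exact h ▸ rfl

theorem mul_eq_letter {x y : TraceMonoid R} {c : α} (h : x * y = letter R c) :
    x = 1 ∧ y = letter R c ∨ x = letter R c ∧ y = 1 := by
  have hlen := congrArg (length R) h
  rw [length_mul, length_letter, Nat.add_eq_one_iff, length_eq_zero_iff,
    length_eq_zero_iff] at hlen
  rcases hlen with ⟨rfl, -⟩ | ⟨-, rfl⟩
  · exact .inl ⟨rfl, by rwa [one_mul] at h⟩
  · exact .inr ⟨by rwa [mul_one] at h, rfl⟩

theorem not_letter_dvd_one (c : α) : ¬letter R c ∣ 1 := by
  rintro ⟨x, h⟩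
  have := congrArg (length R) h
  rw [length_one, length_mul, length_letter] at this
  lia

theorem occ_ofWord [DecidableEq α] (a : α) (w : List α) : occ R a (ofWord R w) = w.count a := by
  rw [occ, letters_ofWord, toAdd_ofAdd, ← Multiset.coe_count]
  congr!

theorem occ_mul (a : α) (x y : TraceMonoid R) : occ R a (x * y) = occ R a x + occ R a y := by
  simp [occ]

theorem occ_letter_self (a : α) : occ R a (letter R a) = 1 := by
  classical simp [letter, occ_ofWord]

/-- The set of the letters that occur in a trace. -/
def supp (x : TraceMonoid R) : Set α := {c | c ∈ (letters R x).toAdd}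

theorem mem_supp_ofWord {w : List α} {c : α} : c ∈ supp (ofWord R w) ↔ c ∈ w := by
  simp [supp, letters_ofWord]

theorem supp_one : supp (1 : TraceMonoid R) = ∅ := by
  simp [supp]

theorem supp_letter (c : α) : supp (letter R c) = {c} := by
  ext; simp [letter, mem_supp_ofWord]

theorem supp_mul (x y : TraceMonoid R) : supp (x * y) = supp x ∪ supp y := by
  ext; simp [supp]

theorem occ_eq_zero_iff {a : α} {x : TraceMonoid R} : occ R a x = 0 ↔ a ∉ supp x := by
  simp [occ, supp, Multiset.count_eq_zero]

theorem mem_sub_iff {S : Set α} {x : TraceMonoid R} : x ∈ sub R S ↔ supp x ⊆ S := by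
  constructor
  · intro hx
    induction hx using Submonoid.closure_induction with
    | mem x hx => obtain ⟨c, hc, rfl⟩ := hx; simpa [supp_letter] using hc
    | one => simp [supp_one]
    | mul x y _ _ hx hy => exact (supp_mul x y).trans_subset (Set.union_subset hx hy)
  · induction x using induction_on with
    | one => exact fun _ => one_mem _
    | letter_mul c x ih =>
      rw [supp_mul, supp_letter, Set.union_subset_iff, Set.singleton_subset_iff]
      exact fun h => mul_mem (Submonoid.subset_closure ⟨c, h.1, rfl⟩) (ih h.2)

theorem mem_sub_compl_singleton_iff {a : α} {x : TraceMonoid R} :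
    x ∈ sub R {a}ᶜ ↔ a ∉ supp x := by
  rw [mem_sub_iff, Set.subset_compl_singleton_iff]

theorem sub_univ : sub R Set.univ = ⊤ :=
  (Submonoid.eq_top_iff' _).2 fun _ => mem_sub_iff.2 (Set.subset_univ _)

/-- Two traces are independent if no letter of the one is related to a letter of the other. -/
def Indep (x y : TraceMonoid R) : Prop := ∀ b ∈ supp x, ∀ c ∈ supp y, ¬R b c

theorem indep_one_left (x : TraceMonoid R) : Indep 1 x := by simp [Indep, supp_one]

theorem indep_one_right (x : TraceMonoid R) : Indep x 1 := by simp [Indep, supp_one]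

theorem indep_mul_left_iff {x y z : TraceMonoid R} :
    Indep (x * y) z ↔ Indep x z ∧ Indep y z := by
  simp only [Indep, supp_mul, Set.mem_union, or_imp, forall_and]

theorem indep_mul_right_iff {x y z : TraceMonoid R} :
    Indep x (y * z) ↔ Indep x y ∧ Indep x z := by
  simp only [Indep, supp_mul, Set.mem_union, or_imp, forall_and]

theorem indep_letter_left_iff {b : α} {x : TraceMonoid R} :
    Indep (letter R b) x ↔ ∀ c ∈ supp x, ¬R b c := by
  simp [Indep, supp_letter]

theorem indep_letter_letter_iff {b c : α} : Indep (letter R b) (letter R c) ↔ ¬R b c := by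
  simp [Indep, supp_letter]

theorem Indep.commute_letter {b : α} {x : TraceMonoid R} (h : Indep (letter R b) x) :
    Commute (letter R b) x := by
  induction x using induction_on with
  | one => exact .one_right _
  | letter_mul c x ih =>
    rw [indep_mul_right_iff, indep_letter_letter_iff] at h
    exact .mul_right (letter_mul_comm h.1) (ih h.2)

end Words

section Projections

variable {α : Type*} {R : α → α → Prop}

theorem of_dvd_of_mul_iff {c d : α} {w : FreeMonoid α} :
    FreeMonoid.of c ∣ FreeMonoid.of d * w ↔ c = d := by
  refine ⟨?_, fun h => h ▸ dvd_mul_right _ _⟩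
  rintro ⟨w', h⟩
  exact (List.cons.inj h).1.symm

theorem not_of_dvd_one (c : α) : ¬FreeMonoid.of c ∣ (1 : FreeMonoid α) := by
  rintro ⟨w, h⟩
  exact List.cons_ne_nil _ _ h.symm

variable [Std.Symm R]

open Classical in
/-- The projection of a trace to two related letters, which is a word since these letters do not
commute. -/
noncomputable def pairProj {a b : α} (hab : R a b) : TraceMonoid R →* FreeMonoid α :=
  PresentedMonoid.lift (fun c => if c = a ∨ c = b then FreeMonoid.of c else 1) (by
    rintro _ _ ⟨c, d, hcd⟩
    simp only [map_mul, FreeMonoid.lift_eval_of]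
    have hba := symm_of R hab
    split_ifs <;> aesop)

open Classical in
theorem pairProj_letter {a b : α} (hab : R a b) (c : α) :
    pairProj hab (letter R c) = if c = a ∨ c = b then FreeMonoid.of c else 1 := rfl

theorem of_dvd_pairProj_letter_mul_iff {c d : α} {x : TraceMonoid R} :
    (∀ b (h : R c b), FreeMonoid.of c ∣ pairProj h (letter R d * x)) ↔
      c = d ∨ ¬R c d ∧ ∀ b (h : R c b), FreeMonoid.of c ∣ pairProj h x := by
  simp only [map_mul, pairProj_letter]
  rcases eq_or_ne c d with rfl | hcd
  · simp
  simp only [hcd, hcd.symm, false_or]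
  constructor
  · intro h
    have hR : ¬R c d := fun hR => hcd (by simpa [of_dvd_of_mul_iff] using h d hR)
    refine ⟨hR, fun b hb => ?_⟩
    have hdb : d ≠ b := by rintro rfl; exact hR hb
    simpa [hcd.symm, hdb] using h b hb
  · rintro ⟨hR, h⟩ b hb
    have hdb : d ≠ b := by rintro rfl; exact hR hb
    simpa [hcd.symm, hdb] using h b hb

variable [Std.Refl R]

theorem letter_dvd_iff_pairProj {c : α} {x : TraceMonoid R} :
    letter R c ∣ x ↔ ∀ b (h : R c b), FreeMonoid.of c ∣ pairProj h x := by
  constructor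
  · rintro ⟨y, rfl⟩
    exact of_dvd_pairProj_letter_mul_iff.2 (.inl rfl)
  · induction x using induction_on with
    | one =>
      exact fun h => (not_of_dvd_one c (by simpa only [map_one] using h c (refl_of R c))).elim
    | letter_mul d x ih =>
      rw [of_dvd_pairProj_letter_mul_iff]
      rintro (rfl | ⟨hcd, h⟩)
      · exact dvd_mul_right _ _
      · obtain ⟨y, rfl⟩ := ih h
        exact ⟨letter R d * y, by rw [← mul_assoc, ← letter_mul_comm hcd, mul_assoc]⟩

theorem letter_dvd_letter_mul_iff {c d : α} {x : TraceMonoid R} :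
    letter R c ∣ letter R d * x ↔ c = d ∨ ¬R c d ∧ letter R c ∣ x := by
  simp only [letter_dvd_iff_pairProj, of_dvd_pairProj_letter_mul_iff]

theorem letter_dvd_mul_iff {c : α} {x y : TraceMonoid R} :
    letter R c ∣ x * y ↔ letter R c ∣ x ∨ Indep (letter R c) x ∧ letter R c ∣ y := by
  induction x using induction_on with
  | one => simp [indep_one_right, not_letter_dvd_one]
  | letter_mul d x ih =>
    rw [mul_assoc, letter_dvd_letter_mul_iff, letter_dvd_letter_mul_iff, ih, indep_mul_right_iff,
      indep_letter_letter_iff]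
    tauto

theorem eq_of_pairProj_eq {x y : TraceMonoid R}
    (h : ∀ a b (hab : R a b), pairProj hab x = pairProj hab y) : x = y := by
  induction x using induction_on generalizing y with
  | one =>
    cases y using induction_on with
    | one => rfl
    | letter_mul c y =>
      have hc := letter_dvd_iff_pairProj.1 (dvd_mul_right (letter R c) y) c (refl_of R c)
      rw [← h, map_one] at hc
      exact (not_of_dvd_one c hc).elim
  | letter_mul c x ih =>
    obtain ⟨y, rfl⟩ : letter R c ∣ y := letter_dvd_iff_pairProj.2 fun b hb =>
      h c b hb ▸ letter_dvd_iff_pairProj.1 (dvd_mul_right _ x) b hb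
    rw [ih fun a b hab => mul_left_cancel (by simpa only [map_mul] using h a b hab)]

instance : IsCancelMul (TraceMonoid R) where
  mul_left_cancel x y z h := eq_of_pairProj_eq fun a b hab =>
    mul_left_cancel (by simpa only [map_mul] using congrArg (pairProj hab) h)
  mul_right_cancel x y z h := eq_of_pairProj_eq fun a b hab =>
    mul_right_cancel (by simpa only [map_mul] using congrArg (pairProj hab) h)

theorem ofWord_dvd_iff {l : List α} (hl : l.Pairwise fun b c => ¬R b c) {x : TraceMonoid R} :
    ofWord R l ∣ x ↔ ∀ c ∈ l, letter R c ∣ x := by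
  induction l generalizing x with
  | nil => simp [ofWord_nil]
  | cons c l ih =>
    rw [List.pairwise_cons] at hl
    rw [ofWord_cons, List.forall_mem_cons]
    by_cases hc : letter R c ∣ x
    · obtain ⟨y, rfl⟩ := hc
      have hcancel : letter R c * ofWord R l ∣ letter R c * y ↔ ofWord R l ∣ y :=
        ⟨fun ⟨z, hz⟩ => ⟨z, mul_left_cancel (hz.trans (mul_assoc _ _ _))⟩, mul_dvd_mul_left _⟩
      rw [hcancel, ih hl.2, and_iff_right (dvd_mul_right _ _)]
      refine forall₂_congr fun d hd => ?_
      have hdc : ¬R d c := fun h => hl.1 d hd (symm_of R h)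
      have hne : d ≠ c := fun h => hdc (h ▸ refl_of R d)
      rw [letter_dvd_letter_mul_iff, or_iff_right hne, and_iff_right hdc]
    · exact iff_of_false (fun h => hc ((dvd_mul_right _ _).trans h)) fun h => hc h.1

theorem exists_mul_eq_mul {x y z t : TraceMonoid R} (h : x * y = z * t) :
    ∃ p q r s, x = p * q ∧ y = r * s ∧ z = p * r ∧ t = q * s ∧ Indep q r := by
  induction x using induction_on generalizing z t with
  | one => exact ⟨1, 1, z, t, by simp, by simpa using h, by simp, by simp, indep_one_left z⟩
  | letter_mul c x ih =>
    rcases letter_dvd_mul_iff.1 ⟨x * y, h.symm.trans (mul_assoc _ _ _)⟩ with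
      ⟨z, rfl⟩ | ⟨hcz, t, rfl⟩
    · rw [mul_assoc, mul_assoc] at h
      obtain ⟨p, q, r, s, rfl, rfl, rfl, rfl, hqr⟩ := ih (mul_left_cancel h)
      exact ⟨letter R c * p, q, r, s, by simp only [mul_assoc], rfl, by simp only [mul_assoc], rfl,
        hqr⟩
    · rw [mul_assoc, ← mul_assoc z, ← hcz.commute_letter.eq, mul_assoc] at h
      obtain ⟨p, q, r, s, rfl, rfl, rfl, rfl, hqr⟩ := ih (mul_left_cancel h)
      rw [indep_mul_right_iff] at hcz
      refine ⟨p, letter R c * q, r, s, ?_, rfl, rfl, by rw [mul_assoc],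
        indep_mul_left_iff.2 ⟨hcz.2, hqr⟩⟩
      rw [← mul_assoc, hcz.1.commute_letter.eq, mul_assoc]

end Projections

section MaxLetters

variable {α : Type*} {R : α → α → Prop}

/-- The letters that can come last in a word for `x`, i.e. the labels of the maximal pieces of the
heap of `x`. -/
def maxLetters (x : TraceMonoid R) : Set α := {c | ∃ y, x = y * letter R c}

theorem maxLetters_subset_supp (x : TraceMonoid R) : maxLetters x ⊆ supp x := by
  rintro c ⟨y, rfl⟩
  simp [supp_mul, supp_letter]

theorem maxLetters_one : maxLetters (1 : TraceMonoid R) = ∅ :=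
  Set.subset_empty_iff.1 ((maxLetters_subset_supp 1).trans_eq supp_one)

theorem maxLetters_letter (c : α) : maxLetters (letter R c) = {c} :=
  (maxLetters_subset_supp _ |>.trans_eq (supp_letter c)).antisymm
    (Set.singleton_subset_iff.2 ⟨1, (one_mul _).symm⟩)

theorem maxLetters_nonempty {x : TraceMonoid R} (hx : x ≠ 1) : (maxLetters x).Nonempty := by
  obtain ⟨w, rfl⟩ := ofWord_surjective x
  cases w using List.reverseRecOn with
  | nil => exact (hx rfl).elim
  | append_singleton w c => exact ⟨c, ofWord R w, rfl⟩

variable [Std.Symm R] [Std.Refl R]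

theorem mem_maxLetters_mul_iff {c : α} {x y : TraceMonoid R} : c ∈ maxLetters (x * y) ↔
    c ∈ maxLetters y ∨ Indep (letter R c) y ∧ c ∈ maxLetters x := by
  constructor
  · rintro ⟨w, h⟩
    obtain ⟨p, q, r, s, rfl, rfl, rfl, hqs, hqr⟩ := exists_mul_eq_mul h
    rcases mul_eq_letter hqs.symm with ⟨rfl, rfl⟩ | ⟨rfl, rfl⟩
    · exact .inl ⟨r, rfl⟩
    · exact .inr ⟨by rwa [mul_one], p, rfl⟩
  · rintro (⟨y, rfl⟩ | ⟨hcy, x, rfl⟩)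
    · exact ⟨x * y, (mul_assoc _ _ _).symm⟩
    · exact ⟨x * y, by rw [mul_assoc, hcy.commute_letter.eq, mul_assoc]⟩

theorem mem_maxLetters_mul_letter_iff {b c : α} {x : TraceMonoid R} :
    b ∈ maxLetters (x * letter R c) ↔ b = c ∨ ¬R b c ∧ b ∈ maxLetters x := by
  rw [mem_maxLetters_mul_iff, maxLetters_letter, Set.mem_singleton_iff, indep_letter_letter_iff]

end MaxLetters

section Heaps

variable {α : Type*} {R : α → α → Prop} {w : List α}

theorem HeapLE.le {i j : Fin w.length} (h : HeapLE R w i j) : i ≤ j := by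
  induction h with
  | refl => exact le_rfl
  | tail _ h ih => exact ih.trans h.1.le

theorem heap_maximal_iff {i : Fin w.length} :
    (∀ j, HeapLE R w i j → j = i) ↔ ∀ j, i < j → ¬R (w.get i) (w.get j) := by
  constructor
  · exact fun h j hij hR => hij.ne' (h j (.single ⟨hij, hR⟩))
  · intro h j hij
    rcases hij.cases_head with rfl | ⟨k, hik, -⟩
    · rfl
    · exact (h k hik.1 hik.2).elim

theorem exists_heapLE_maximal (i : Fin w.length) :
    ∃ j, HeapLE R w i j ∧ ∀ k, HeapLE R w j k → k = j := by
  induction i using WellFoundedGT.induction with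
  | ind i ih =>
    by_cases hi : ∀ k, HeapLE R w i k → k = i
    · exact ⟨i, .refl, hi⟩
    · push Not at hi
      obtain ⟨k, hik, hne⟩ := hi
      obtain ⟨j, hkj, hj⟩ := ih k (hik.le.lt_of_ne' hne)
      exact ⟨j, hik.trans hkj, hj⟩

theorem below_eq_ofWord {i : Fin w.length} (h : ∀ j, HeapLE R w j i) :
    below R w i = ofWord R w := by
  simp [below, h]

theorem occ_below {a : α} {i : Fin w.length} (hi : w.get i = a) (hlt : ∀ j < i, w.get j ≠ a) :
    occ R a (below R w i) = 1 := by
  classical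
  have hiff : ∀ j ∈ (List.finRange w.length).filter (HeapLE R w · i),
      (w.get j == a) = true ↔ (j == i) = true := fun j hj => by
    rw [beq_iff_eq, beq_iff_eq]
    have hji : HeapLE R w j i := by simpa using hj
    exact ⟨fun h => hji.le.eq_of_not_lt fun hlt' => hlt j hlt' h, fun h => h ▸ hi⟩
  rw [below, occ_ofWord, List.count, List.countP_map]
  refine (List.countP_congr hiff).trans
    (List.count_eq_one_of_mem ((List.nodup_finRange _).filter _) ?_)
  exact List.mem_filter.2 ⟨List.mem_finRange i, decide_eq_true .refl⟩

variable [Std.Symm R] [Std.Refl R]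

theorem mem_maxLetters_ofWord_map_iff {ι : Type*} [Preorder ι] {l : List ι}
    (hl : l.Pairwise (· < ·)) {f : ι → α} {c : α} :
    c ∈ maxLetters (ofWord R (l.map f)) ↔ ∃ i ∈ l, f i = c ∧ ∀ j ∈ l, i < j → ¬R c (f j) := by
  induction l with
  | nil => simp [ofWord_nil, maxLetters_one]
  | cons k l ih =>
    rw [List.pairwise_cons] at hl
    have hkl : ∀ i ∈ l, ¬i < k := fun i hi => (hl.1 i hi).asymm
    rw [List.map_cons, ofWord_cons, mem_maxLetters_mul_iff, ih hl.2, maxLetters_letter]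
    simp only [List.mem_cons, exists_eq_or_imp, forall_eq_or_imp, lt_irrefl,
      indep_letter_left_iff, mem_supp_ofWord, List.mem_map, forall_exists_index, and_imp,
      forall_apply_eq_imp_iff₂, Set.mem_singleton_iff]
    grind

theorem mem_maxLetters_ofWord_iff {c : α} : c ∈ maxLetters (ofWord R w) ↔
    ∃ i : Fin w.length, (∀ j, HeapLE R w i j → j = i) ∧ w.get i = c := by
  have h := mem_maxLetters_ofWord_map_iff (R := R) (List.pairwise_lt_finRange w.length)
    (f := w.get) (c := c)
  rw [List.map_get_finRange] at h
  simp only [h, heap_maximal_iff, List.mem_finRange, true_and, forall_const]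
  exact exists_congr fun i => ⟨fun ⟨h, h'⟩ => ⟨h ▸ h', h⟩, fun ⟨h', h⟩ => ⟨h, h ▸ h'⟩⟩

theorem maxIn_iff {U : Set α} {x : TraceMonoid R} : MaxIn R U x ↔ maxLetters x ⊆ U := by
  constructor
  · obtain ⟨w, rfl⟩ := ofWord_surjective x
    intro h c hc
    obtain ⟨i, hi, rfl⟩ := mem_maxLetters_ofWord_iff.1 hc
    exact h w rfl i hi
  · rintro h w rfl i hi
    exact h (mem_maxLetters_ofWord_iff.2 ⟨i, hi, rfl⟩)

theorem maxLetters_below (i : Fin w.length) : maxLetters (below R w i) = {w.get i} := by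
  ext c
  rw [below, mem_maxLetters_ofWord_map_iff ((List.pairwise_lt_finRange _).filter _),
    Set.mem_singleton_iff]
  simp only [List.mem_filter, List.mem_finRange, true_and, decide_eq_true_eq]
  constructor
  · rintro ⟨j, hji, rfl, hj⟩
    rcases hji.cases_head with rfl | ⟨k, hjk, hki⟩
    · rfl
    · exact (hj k hki hjk.1 hjk.2).elim
  · rintro rfl
    exact ⟨i, .refl, rfl, fun j hji hij => (hij.not_ge hji.le).elim⟩

theorem mem_pyr_iff {a : α} {u : TraceMonoid R} :
    u ∈ pyr R a ↔ maxLetters u = {a} ∧ occ R a u = 1 := by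
  constructor
  · rintro ⟨w, i, hi, hlt, rfl⟩
    exact ⟨hi ▸ maxLetters_below i, occ_below hi hlt⟩
  · rintro ⟨hmax, hocc⟩
    obtain ⟨v, rfl⟩ : a ∈ maxLetters u := hmax ▸ rfl
    obtain ⟨w, rfl⟩ := ofWord_surjective v
    rw [occ_mul, occ_letter_self, Nat.add_eq_right, occ_eq_zero_iff, mem_supp_ofWord] at hocc
    have hlast : ∀ j : Fin (w ++ [a]).length, (w ++ [a]).get j = a ↔ j = ⟨w.length, by simp⟩ := by
      intro j
      refine ⟨fun hj => Fin.ext ?_, fun hj => by simp [hj]⟩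
      by_contra hne
      have hjw : j.1 < w.length := by have := j.2; grind
      exact hocc (hj ▸ by simp [hjw])
    refine ⟨w ++ [a], ⟨w.length, by simp⟩, (hlast _).2 rfl,
      fun j hj h => hj.ne ((hlast j).1 h), (below_eq_ofWord fun j => ?_).symm⟩
    obtain ⟨k, hjk, hk⟩ := exists_heapLE_maximal (R := R) j
    have hka : (w ++ [a]).get k ∈ ({a} : Set α) :=
      hmax ▸ mem_maxLetters_ofWord_iff.2 ⟨k, hk, rfl⟩
    rwa [← (hlast k).1 hka]

theorem mul_letter_mem_pyr_iff {a : α} {v : TraceMonoid R} :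
    v * letter R a ∈ pyr R a ↔ v ∈ sub R {a}ᶜ ∧ MaxIn R (link R a) v := by
  have hmax : maxLetters (v * letter R a) = {a} ↔ maxLetters v ⊆ link R a := by
    simp only [Set.ext_iff, mem_maxLetters_mul_letter_iff, Set.mem_singleton_iff,
      or_iff_left_iff_imp, Set.subset_def, link, Set.mem_ofPred_eq]
    refine forall_congr' fun b => ?_
    rw [comm_of R]
    have := refl_of R a
    grind
  rw [mem_pyr_iff, hmax, maxIn_iff, occ_mul, occ_letter_self, Nat.add_eq_right, occ_eq_zero_iff,
    mem_sub_compl_singleton_iff, and_comm]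

theorem pyr_eq_image (a : α) :
    pyr R a = (· * letter R a) '' {v | v ∈ sub R {a}ᶜ ∧ MaxIn R (link R a) v} := by
  ext u
  constructor
  · intro hu
    obtain ⟨v, rfl⟩ : a ∈ maxLetters u := (mem_pyr_iff.1 hu).1 ▸ rfl
    exact ⟨v, mul_letter_mem_pyr_iff.1 hu, rfl⟩
  · rintro ⟨v, hv, rfl⟩
    exact mul_letter_mem_pyr_iff.2 hv

theorem existsUnique_eq_mul_letter {a : α} {u : TraceMonoid R} (hu : u ∈ pyr R a) :
    ∃! v, v ∈ sub R {a}ᶜ ∧ u = v * letter R a := by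
  rw [pyr_eq_image] at hu
  obtain ⟨v, hv, rfl⟩ := hu
  exact ⟨v, ⟨hv.1, rfl⟩, fun v' hv' => (mul_right_cancel hv'.2).symm⟩

theorem maxIn_one (U : Set α) : MaxIn R U 1 := by
  simp [maxIn_iff, maxLetters_one]

theorem pyr_nonempty (a : α) : (pyr R a).Nonempty := by
  rw [pyr_eq_image]
  exact ⟨_, 1, ⟨one_mem _, maxIn_one _⟩, rfl⟩

end Heaps

section Decomposition

variable {α : Type*} {R : α → α → Prop}

theorem isPyrDecomp_zero_iff {a : α} {x : TraceMonoid R} {u : Fin 1 → TraceMonoid R} :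
    IsPyrDecomp R a x 0 u ↔ u 0 = x ∧ x ∈ sub R {a}ᶜ := by
  constructor
  · rintro ⟨-, hrem, hprod⟩
    obtain rfl : u 0 = x := by simpa using hprod
    exact ⟨rfl, hrem⟩
  · rintro ⟨rfl, hx⟩
    exact ⟨fun i => i.elim0, hx, by simp⟩

theorem isPyrDecomp_succ_iff {a : α} {x : TraceMonoid R} {k : ℕ}
    {u : Fin (k + 2) → TraceMonoid R} : IsPyrDecomp R a x (k + 1) u ↔
      u 0 ∈ pyr R a ∧ ∃ y, u 0 * y = x ∧ IsPyrDecomp R a y k (Fin.tail u) := by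
  constructor
  · rintro ⟨hpyr, hrem, hprod⟩
    refine ⟨hpyr 0, _, ?_, fun i => hpyr i.succ, hrem, rfl⟩
    rw [← hprod, List.ofFn_succ (f := u), List.prod_cons]
    rfl
  · rintro ⟨h0, y, rfl, hpyr, hrem, rfl⟩
    refine ⟨Fin.cases h0 hpyr, hrem, ?_⟩
    rw [List.ofFn_succ, List.prod_cons]
    rfl

variable [Std.Symm R] [Std.Refl R] {a : α}

theorem eq_of_mem_pyr_of_mul_eq_mul {u u' y y' : TraceMonoid R} (hu : u ∈ pyr R a)
    (hu' : u' ∈ pyr R a) (h : u * y = u' * y') : u = u' := by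
  obtain ⟨p, q, r, s, rfl, -, rfl, -, hqr⟩ := exists_mul_eq_mul h
  have eq_one : ∀ {z}, p * z ∈ pyr R a → a ∉ supp z → z = 1 := fun {z} hz haz => by
    by_contra hne
    obtain ⟨c, hc⟩ := maxLetters_nonempty hne
    have hca : c ∈ ({a} : Set α) :=
      (mem_pyr_iff.1 hz).1 ▸ mem_maxLetters_mul_iff.2 (.inl hc)
    exact haz (hca ▸ maxLetters_subset_supp z hc)
  have hocc : occ R a q = occ R a r := by
    have hq := (mem_pyr_iff.1 hu).2
    have hr := (mem_pyr_iff.1 hu').2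
    rw [occ_mul] at hq hr
    lia
  have haq : a ∉ supp q := fun haq => hqr a haq a
    (by_contra fun har => occ_eq_zero_iff.1 (hocc.trans (occ_eq_zero_iff.2 har)) haq) (refl_of R a)
  rw [eq_one hu haq, eq_one hu' (occ_eq_zero_iff.1 (hocc ▸ occ_eq_zero_iff.2 haq))]

/-- A shortest left factor of `x` that contains `a` is pyramidal. -/
theorem exists_mem_pyr_mul_eq {x : TraceMonoid R} (hx : a ∈ supp x) :
    ∃ u ∈ pyr R a, ∃ y, u * y = x := by
  induction hn : length R x using Nat.strong_induction_on generalizing x with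
  | h n ih =>
    by_cases hfactor : ∃ z b, x = z * letter R b ∧ a ∈ supp z
    · obtain ⟨z, b, rfl, haz⟩ := hfactor
      rw [length_mul, length_letter] at hn
      obtain ⟨u, hu, y, rfl⟩ := ih _ (by lia) haz rfl
      exact ⟨u, hu, y * letter R b, (mul_assoc _ _ _).symm⟩
    · push Not at hfactor
      refine ⟨x, ?_, 1, mul_one x⟩
      have hne : x ≠ 1 := by rintro rfl; simp [supp_one] at hx
      obtain ⟨b, v, rfl⟩ := maxLetters_nonempty hne
      have hav : a ∉ supp v := hfactor v b rfl
      obtain rfl : a = b := by simpa [supp_mul, supp_letter, hav] using hx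
      rw [mul_letter_mem_pyr_iff, mem_sub_compl_singleton_iff, maxIn_iff]
      refine ⟨hav, ?_⟩
      rintro c ⟨z, rfl⟩
      by_contra hac
      refine hfactor (z * letter R a) c ?_ (by simp [supp_mul, supp_letter])
      rw [mul_assoc, mul_assoc, letter_mul_comm hac]

theorem maxIn_mul_iff_of_mem_pyr {T : Set α} (ha : a ∈ T) {u y : TraceMonoid R}
    (hu : u ∈ pyr R a) : MaxIn R T (u * y) ↔ MaxIn R T y := by
  simp only [maxIn_iff, Set.subset_def, mem_maxLetters_mul_iff, (mem_pyr_iff.1 hu).1,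
    Set.mem_singleton_iff]
  grind

theorem IsPyrDecomp.occ_eq {x : TraceMonoid R} {k : ℕ} {u : Fin (k + 1) → TraceMonoid R}
    (h : IsPyrDecomp R a x k u) : occ R a x = k := by
  induction k generalizing x with
  | zero => exact occ_eq_zero_iff.2 (mem_sub_compl_singleton_iff.1 (isPyrDecomp_zero_iff.1 h).2)
  | succ k ih =>
    obtain ⟨h0, y, rfl, htail⟩ := isPyrDecomp_succ_iff.1 h
    rw [occ_mul, (mem_pyr_iff.1 h0).2, ih htail, add_comm]

theorem IsPyrDecomp.maxIn_iff {T : Set α} (ha : a ∈ T) {x : TraceMonoid R} {k : ℕ}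
    {u : Fin (k + 1) → TraceMonoid R} (h : IsPyrDecomp R a x k u) :
    MaxIn R T x ↔ MaxIn R T (u (Fin.last k)) := by
  induction k generalizing x with
  | zero => rw [← (isPyrDecomp_zero_iff.1 h).1]; rfl
  | succ k ih =>
    obtain ⟨h0, y, rfl, htail⟩ := isPyrDecomp_succ_iff.1 h
    exact (maxIn_mul_iff_of_mem_pyr ha h0).trans (ih htail)

theorem IsPyrDecomp.unique {x : TraceMonoid R} {k : ℕ} {u u' : Fin (k + 1) → TraceMonoid R}
    (h : IsPyrDecomp R a x k u) (h' : IsPyrDecomp R a x k u') : u = u' := by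
  induction k generalizing x with
  | zero =>
    funext i
    rw [Fin.fin_one_eq_zero i, (isPyrDecomp_zero_iff.1 h).1, (isPyrDecomp_zero_iff.1 h').1]
  | succ k ih =>
    obtain ⟨h0, y, rfl, htail⟩ := isPyrDecomp_succ_iff.1 h
    obtain ⟨h0', y', hy', htail'⟩ := isPyrDecomp_succ_iff.1 h'
    have hu0 : u' 0 = u 0 := eq_of_mem_pyr_of_mul_eq_mul h0' h0 hy'
    obtain rfl : y' = y := mul_left_cancel (hu0 ▸ hy')
    rw [← Fin.cons_self_tail u, ← Fin.cons_self_tail u', hu0, ih htail htail']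

theorem exists_isPyrDecomp (a : α) (x : TraceMonoid R) :
    ∃ u, IsPyrDecomp R a x (occ R a x) u := by
  induction hk : occ R a x generalizing x with
  | zero =>
    exact ⟨fun _ => x, isPyrDecomp_zero_iff.2
      ⟨rfl, mem_sub_compl_singleton_iff.2 (occ_eq_zero_iff.1 hk)⟩⟩
  | succ k ih =>
    have hx : a ∈ supp x := by
      by_contra hx
      simp [occ_eq_zero_iff.2 hx] at hk
    obtain ⟨u₀, hu₀, y, rfl⟩ := exists_mem_pyr_mul_eq hx
    rw [occ_mul, (mem_pyr_iff.1 hu₀).2, add_comm, Nat.add_right_cancel_iff] at hk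
    obtain ⟨u, hu⟩ := ih y hk
    exact ⟨Fin.cons u₀ u, isPyrDecomp_succ_iff.2 ⟨hu₀, y, rfl, hu⟩⟩

theorem existsUnique_isPyrDecomp (a : α) (x : TraceMonoid R) :
    ∃! u, IsPyrDecomp R a x (occ R a x) u :=
  (exists_isPyrDecomp a x).imp fun _ hu => ⟨hu, fun _ hu' => hu'.unique hu⟩

/-- The sets that the factors `u₀, …, u_k` of a trace `x` with `k` occurrences of `a` and
`max(x) ⊆ T` range over. -/
def factorSet (R : α → α → Prop) (a : α) (T : Set α) (k : ℕ) : Fin (k + 1) → Set (TraceMonoid R) :=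
  Fin.snoc (fun _ => pyr R a) {x | x ∈ sub R {a}ᶜ ∧ MaxIn R T x}

theorem factorSet_nonempty (a : α) (T : Set α) (k : ℕ) (i : Fin (k + 1)) :
    (factorSet R a T k i).Nonempty := by
  induction i using Fin.lastCases with
  | last => exact ⟨1, by simp [factorSet, one_mem, maxIn_one]⟩
  | cast i => simpa [factorSet] using pyr_nonempty a

theorem mem_pi_factorSet_iff {T : Set α} (ha : a ∈ T) {k : ℕ} {u : Fin (k + 1) → TraceMonoid R} :
    u ∈ Set.univ.pi (factorSet R a T k) ↔
      IsPyrDecomp R a (List.ofFn u).prod k u ∧ MaxIn R T (List.ofFn u).prod := by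
  have hpi : u ∈ Set.univ.pi (factorSet R a T k) ↔ (∀ i : Fin k, u i.castSucc ∈ pyr R a) ∧
      u (Fin.last k) ∈ sub R {a}ᶜ ∧ MaxIn R T (u (Fin.last k)) := by
    simp [Fin.forall_fin_succ', factorSet]
  rw [hpi]
  constructor
  · rintro ⟨hpyr, hrem, hmax⟩
    have h : IsPyrDecomp R a (List.ofFn u).prod k u := ⟨hpyr, hrem, rfl⟩
    exact ⟨h, (h.maxIn_iff ha).2 hmax⟩
  · rintro ⟨h, hmax⟩
    exact ⟨h.pyramidal, h.remainder, (h.maxIn_iff ha).1 hmax⟩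

theorem injOn_prod_factorSet {T : Set α} (ha : a ∈ T) (k : ℕ) :
    Set.InjOn (fun u => (List.ofFn u).prod) (Set.univ.pi (factorSet R a T k)) :=
  fun u hu u' hu' (h : (List.ofFn u).prod = (List.ofFn u').prod) =>
    ((mem_pi_factorSet_iff ha).1 hu).1.unique (h ▸ ((mem_pi_factorSet_iff ha).1 hu').1)

theorem image_prod_factorSet {T : Set α} (ha : a ∈ T) (k : ℕ) :
    (fun u => (List.ofFn u).prod) '' Set.univ.pi (factorSet R a T k) =
      {x | MaxIn R T x} ∩ {x | occ R a x = k} := by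
  ext x
  constructor
  · rintro ⟨u, hu, rfl⟩
    obtain ⟨h, hmax⟩ := (mem_pi_factorSet_iff ha).1 hu
    exact ⟨hmax, h.occ_eq⟩
  · rintro ⟨hmax, rfl⟩
    obtain ⟨u, hu⟩ := exists_isPyrDecomp a x
    refine ⟨u, (mem_pi_factorSet_iff ha).2 ?_, hu.prod_eq⟩
    rw [hu.prod_eq]
    exact ⟨hu, hmax⟩

end Decomposition

section Mobius

variable {α : Type*} {R : α → α → Prop}

theorem finite_setOf_length_eq [Finite α] (R : α → α → Prop) (S : Set α) (n : ℕ) :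
    {x : TraceMonoid R | x ∈ sub R S ∧ length R x = n}.Finite := by
  refine ((List.finite_length_eq α n).image (ofWord R)).subset ?_
  rintro x ⟨-, hx⟩
  obtain ⟨w, rfl⟩ := ofWord_surjective x
  exact ⟨w, (length_ofWord w).symm.trans hx, rfl⟩

variable [Fintype α]

/-- The traces of length `n` on the letters of `S`. -/
noncomputable def tracesOfLength (R : α → α → Prop) (S : Set α) (n : ℕ) :
    Finset (TraceMonoid R) :=
  (finite_setOf_length_eq R S n).toFinset

theorem mem_tracesOfLength {S : Set α} {n : ℕ} {x : TraceMonoid R} :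
    x ∈ tracesOfLength R S n ↔ x ∈ sub R S ∧ length R x = n :=
  Set.Finite.mem_toFinset _

theorem tracesOfLength_mono {S S' : Set α} (h : S ⊆ S') (n : ℕ) :
    tracesOfLength R S n ⊆ tracesOfLength R S' n := by
  intro x
  simp only [mem_tracesOfLength, mem_sub_iff]
  exact fun hx => ⟨hx.1.trans h, hx.2⟩

/-- The generating series of the traces on the letters of `S`, by length. -/
noncomputable def genSeries (A : Type*) [Semiring A] (R : α → α → Prop) (S : Set α) :
    PowerSeries A :=
  .mk fun n => (tracesOfLength R S n).card

theorem coeff_genSeries (A : Type*) [Semiring A] (S : Set α) (n : ℕ) :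
    PowerSeries.coeff n (genSeries A R S) = (tracesOfLength R S n).card :=
  PowerSeries.coeff_mk _ _

open Classical in
/-- The labels of the minimal pieces of the heap of a trace. -/
noncomputable def minLetters (x : TraceMonoid R) : Finset α := {c | letter R c ∣ x}

theorem mem_minLetters {x : TraceMonoid R} {c : α} : c ∈ minLetters x ↔ letter R c ∣ x := by
  simp [minLetters]

theorem minLetters_eq_empty_iff {x : TraceMonoid R} : minLetters x = ∅ ↔ x = 1 := by
  simp only [Finset.eq_empty_iff_forall_notMem, mem_minLetters]
  cases x using induction_on with
  | one => simp [not_letter_dvd_one]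
  | letter_mul c x =>
    exact iff_of_false (fun h => h c (dvd_mul_right _ _))
      fun h => not_letter_dvd_one c (h ▸ dvd_mul_right _ _)

open Classical in
/-- The cliques in `S`, i.e. the sets of pairwise commuting letters of `S`. -/
noncomputable def cliques (R : α → α → Prop) (S : Set α) : Finset (Finset α) :=
  {γ | (∀ a ∈ γ, a ∈ S) ∧ ∀ a ∈ γ, ∀ b ∈ γ, a ≠ b → ¬R a b}

theorem mem_cliques {S : Set α} {γ : Finset α} : γ ∈ cliques R S ↔
    (∀ a ∈ γ, a ∈ S) ∧ ∀ a ∈ γ, ∀ b ∈ γ, a ≠ b → ¬R a b := by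
  simp [cliques]

theorem coe_map_mobius (A : Type*) [CommRing A] (S : Set α) :
    ((mobius R S).map (algebraMap ℤ A) : PowerSeries A) =
      ∑ γ ∈ cliques R S, (-1) ^ γ.card * PowerSeries.X ^ γ.card := by
  rw [mobius, Polynomial.map_sum, ← Polynomial.coeToPowerSeries.ringHom_apply, map_sum]
  exact Finset.sum_congr rfl fun γ _ => by simp

variable [Std.Symm R] [Std.Refl R]

theorem subset_minLetters_iff {S : Set α} {γ : Finset α} (hγ : γ ∈ cliques R S)
    {x : TraceMonoid R} : γ ⊆ minLetters x ↔ ofWord R γ.toList ∣ x := by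
  have hpair : γ.toList.Pairwise fun b c => ¬R b c := γ.nodup_toList.imp_of_mem fun hb hc =>
    (mem_cliques.1 hγ).2 _ (Finset.mem_toList.1 hb) _ (Finset.mem_toList.1 hc)
  simp only [ofWord_dvd_iff hpair, Finset.mem_toList, Finset.subset_iff, mem_minLetters]

open Classical in
theorem filter_cliques_subset_minLetters {S : Set α} {x : TraceMonoid R} (hx : x ∈ sub R S) :
    {γ ∈ cliques R S | γ ⊆ minLetters x} = (minLetters x).powerset := by
  ext γ
  rw [Finset.mem_filter, Finset.mem_powerset, and_iff_right_iff_imp, mem_cliques]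
  refine fun h => ⟨fun c hc => ?_, fun c hc d hd hcd => ?_⟩
  · obtain ⟨y, rfl⟩ := mem_minLetters.1 (h hc)
    exact mem_sub_iff.1 hx (by simp [supp_mul, supp_letter])
  · obtain ⟨y, rfl⟩ := mem_minLetters.1 (h hd)
    exact ((letter_dvd_letter_mul_iff.1 (mem_minLetters.1 (h hc))).resolve_left hcd).1

open Classical in
theorem card_filter_dvd {S : Set α} {z : TraceMonoid R} (hz : z ∈ sub R S) (n : ℕ) :
    {x ∈ tracesOfLength R S n | z ∣ x}.card =
      if length R z ≤ n then (tracesOfLength R S (n - length R z)).card else 0 := by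
  split_ifs with hn
  · rw [← Finset.card_image_of_injective (tracesOfLength R S _) (mul_right_injective z)]
    congr 1
    ext x
    rw [mem_sub_iff] at hz
    simp only [Finset.mem_filter, Finset.mem_image, mem_tracesOfLength, mem_sub_iff]
    constructor
    · rintro ⟨⟨hx, hlen⟩, y, rfl⟩
      rw [supp_mul, Set.union_subset_iff] at hx
      rw [length_mul] at hlen
      exact ⟨y, ⟨hx.2, Nat.eq_sub_of_add_eq' hlen⟩, rfl⟩
    · rintro ⟨y, ⟨hy, hlen⟩, hzy⟩
      rw [← hzy, supp_mul, length_mul, hlen, Nat.add_sub_cancel' hn]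
      exact ⟨⟨Set.union_subset hz hy, rfl⟩, dvd_mul_right z y⟩
  · rw [Finset.card_eq_zero, Finset.filter_eq_empty_iff]
    rintro x hx ⟨y, rfl⟩
    rw [mem_tracesOfLength, length_mul] at hx
    lia

open Classical in
theorem coeff_neg_one_pow_mul_X_pow_mul_genSeries {A : Type*} [CommRing A] {S : Set α}
    {γ : Finset α} (hγ : γ ∈ cliques R S) (n : ℕ) :
    PowerSeries.coeff n ((-1) ^ γ.card * PowerSeries.X ^ γ.card * genSeries A R S) =
      ∑ x ∈ tracesOfLength R S n, if γ ⊆ minLetters x then (-1) ^ γ.card else 0 := by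
  have hsub : ofWord R γ.toList ∈ sub R S := mem_sub_iff.2 fun c hc =>
    (mem_cliques.1 hγ).1 c (by simpa [mem_supp_ofWord] using hc)
  have hC : ((-1) ^ γ.card : PowerSeries A) = PowerSeries.C ((-1) ^ γ.card) := by simp
  simp only [subset_minLetters_iff hγ]
  rw [← Finset.sum_filter, Finset.sum_const, card_filter_dvd hsub, length_ofWord,
    Finset.length_toList, hC, mul_assoc, PowerSeries.coeff_C_mul, PowerSeries.coeff_X_pow_mul']
  split_ifs <;> simp [coeff_genSeries, mul_comm]

/-- Exchanging the sums over cliques and over traces leaves, for each trace, the alternating sum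
over all sets of minimal letters, which vanishes unless the trace is empty. -/
theorem mobius_mul_genSeries (A : Type*) [CommRing A] (S : Set α) :
    ((mobius R S).map (algebraMap ℤ A) : PowerSeries A) * genSeries A R S = 1 := by
  classical
  ext n
  have hinner : ∀ x ∈ tracesOfLength R S n,
      (∑ γ ∈ cliques R S, if γ ⊆ minLetters x then (-1 : A) ^ γ.card else 0) =
        if x = 1 then 1 else 0 := fun x hx => by
    rw [← Finset.sum_filter, filter_cliques_subset_minLetters (mem_tracesOfLength.1 hx).1]
    exact_mod_cast (congrArg (Int.cast (R := A)) Finset.sum_powerset_neg_one_pow_card).trans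
      (by simp [minLetters_eq_empty_iff])
  rw [coe_map_mobius, Finset.sum_mul, map_sum,
    Finset.sum_congr rfl fun γ hγ => coeff_neg_one_pow_mul_X_pow_mul_genSeries hγ n,
    Finset.sum_comm, Finset.sum_congr rfl hinner, Finset.sum_ite_eq', PowerSeries.coeff_one]
  simp [mem_tracesOfLength, length_one, one_mem, eq_comm]

end Mobius

section Analytic

variable {α : Type*} [Fintype α] {R : α → α → Prop}

theorem aeval_mobius_ne_zero_of_enorm_lt {S : Set α} {z : ℂ} (hz : ‖z‖ₑ < smallestRoot R S) :
    Polynomial.aeval z (mobius R S) ≠ 0 :=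
  fun h => hz.not_ge (iInf₂_le z h)

variable [Std.Symm R] [Std.Refl R]

theorem aeval_mobius_mul_tsum {𝕜 : Type*} [RCLike 𝕜] {S : Set α} {z : 𝕜}
    (hs : Summable fun n => ((tracesOfLength R S n).card : ℝ) * ‖z‖ ^ n) :
    Polynomial.aeval z (mobius R S) * ∑' n, ((tracesOfLength R S n).card : 𝕜) * z ^ n = 1 := by
  have := eval_mul_tsum_eq_one_of_mul_eq_one (mobius_mul_genSeries 𝕜 (R := R) S) (z := z) (by
    simpa [coeff_genSeries] using hs)
  simpa only [Polynomial.eval_map_algebraMap, coeff_genSeries] using this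

theorem summable_card_tracesOfLength_mul_pow {S : Set α} {p : ℝ} (hp0 : 0 ≤ p)
    (hp : ENNReal.ofReal p < smallestRoot R S) :
    Summable fun n => ((tracesOfLength R S n).card : ℝ) * p ^ n := by
  obtain ⟨q, hpq, hq⟩ := ENNReal.lt_iff_exists_nnreal_btwn.1 hp
  lift p to NNReal using hp0
  rw [ENNReal.ofReal_coe_nnreal, ENNReal.coe_lt_coe] at hpq
  have := summable_norm_coeff_mul_pow_of_mul_eq_one (mobius_mul_genSeries ℂ (R := R) S) hpq
    fun z hz => by
      rw [Polynomial.eval_map_algebraMap]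
      refine aeval_mobius_ne_zero_of_enorm_lt (lt_of_le_of_lt ?_ hq)
      exact ENNReal.coe_le_coe.2 (mem_closedBall_zero_iff.1 hz)
  simpa [coeff_genSeries] using this

theorem smallestRoot_anti {S S' : Set α} (h : S ⊆ S') : smallestRoot R S' ≤ smallestRoot R S := by
  refine le_iInf₂ fun z hz => ?_
  by_contra! hlt
  rw [← ofReal_norm] at hlt
  have hs : Summable fun n => ((tracesOfLength R S n).card : ℝ) * ‖z‖ ^ n :=
    .of_nonneg_of_le (fun n => by positivity)
      (fun n => by gcongr; exact tracesOfLength_mono h n)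
      (summable_card_tracesOfLength_mul_pow (norm_nonneg z) hlt)
  exact left_ne_zero_of_mul (aeval_mobius_mul_tsum hs ▸ one_ne_zero) hz

theorem mobiusAt_mul_tsum {S : Set α} {p : ℝ} (hp0 : 0 ≤ p)
    (hp : ENNReal.ofReal p < smallestRoot R S) :
    mobiusAt R S p * ∑' n, ((tracesOfLength R S n).card : ℝ) * p ^ n = 1 :=
  aeval_mobius_mul_tsum (𝕜 := ℝ) <| by
    simpa only [Real.norm_of_nonneg hp0] using summable_card_tracesOfLength_mul_pow hp0 hp

theorem mobiusAt_pos {S : Set α} {p : ℝ} (hp0 : 0 ≤ p)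
    (hp : ENNReal.ofReal p < smallestRoot R S) : 0 < mobiusAt R S p :=
  pos_of_mul_pos_left ((mobiusAt_mul_tsum hp0 hp).symm ▸ one_pos) <|
    tsum_nonneg fun n => by positivity

end Analytic

section Weight

variable {α : Type*} {R : α → α → Prop}

instance : DiscreteMeasurableSpace (TraceMonoid R) := ⟨fun _ => trivial⟩

instance [Countable α] : Countable (TraceMonoid R) := ofWord_surjective.countable

/-- The multiplicative measure of parameter `q`, which gives mass `q^|x|` to each trace `x`. All
the laws under consideration are conditionings of this measure. -/
noncomputable def weight (R : α → α → Prop) (q : ℝ≥0∞) : Measure (TraceMonoid R) :=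
  Measure.sum fun x => q ^ length R x • Measure.dirac x

theorem weight_singleton (q : ℝ≥0∞) (x : TraceMonoid R) : weight R q {x} = q ^ length R x :=
  Measure.sum_smul_dirac_singleton

theorem weight_singleton_mul (q : ℝ≥0∞) (x y : TraceMonoid R) :
    weight R q {x * y} = weight R q {x} * weight R q {y} := by
  simp only [weight_singleton, length_mul, pow_add]

theorem weight_singleton_prod_ofFn (q : ℝ≥0∞) {n : ℕ} (u : Fin n → TraceMonoid R) :
    weight R q {(List.ofFn u).prod} = ∏ i, weight R q {u i} := by
  induction n with
  | zero => simp [weight_singleton, length_one]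
  | succ n ih => rw [List.ofFn_succ, List.prod_cons, weight_singleton_mul, ih, Fin.prod_univ_succ]

theorem weight_singleton_prod_eq_one_mul_pi (q : ℝ≥0∞) [SigmaFinite (weight R q)] {n : ℕ}
    (u : Fin n → TraceMonoid R) :
    weight R q {(List.ofFn u).prod} = 1 * Measure.pi (fun _ => weight R q) {u} := by
  rw [one_mul, weight_singleton_prod_ofFn, Measure.pi_singleton]

theorem weight_ne_zero {q : ℝ≥0∞} (hq : q ≠ 0) {s : Set (TraceMonoid R)} (hs : s.Nonempty) :
    weight R q s ≠ 0 := by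
  obtain ⟨x, hx⟩ := hs
  refine (lt_of_lt_of_le ?_ (measure_mono (Set.singleton_subset_iff.2 hx))).ne'
  rw [weight_singleton]
  exact pos_iff_ne_zero.2 (pow_ne_zero _ hq)

variable [Fintype α]

theorem weight_sub_eq_tsum (q : ℝ≥0∞) (S : Set α) :
    weight R q (sub R S) = ∑' n, (tracesOfLength R S n).card * q ^ n := by
  have hfiber : ∀ n, ((weight R q).restrict (sub R S)) (length R ⁻¹' {n}) =
      (tracesOfLength R S n).card * q ^ n := fun n => by
    have heq : length R ⁻¹' {n} ∩ sub R S = tracesOfLength R S n := by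
      ext x
      simp [mem_tracesOfLength, and_comm]
    rw [Measure.restrict_apply .of_discrete, heq, ← sum_measure_singleton, ← nsmul_eq_mul,
      ← Finset.sum_const]
    refine Finset.sum_congr rfl fun x hx => ?_
    rw [weight_singleton, (mem_tracesOfLength.1 hx).2]
  have := tsum_measure_preimage_singleton (μ := (weight R q).restrict (sub R S))
    (f := length R) Set.countable_univ fun _ _ => .of_discrete
  rw [Set.preimage_univ, Measure.restrict_apply_univ, tsum_univ
    fun n => (weight R q).restrict (sub R S) (length R ⁻¹' {n})] at this
  rw [← this]
  exact tsum_congr hfiber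

variable [Std.Symm R] [Std.Refl R]

theorem weight_sub {S : Set α} {p : ℝ} (hp0 : 0 ≤ p) (hp : ENNReal.ofReal p < smallestRoot R S) :
    weight R (.ofReal p) (sub R S) = (ENNReal.ofReal (mobiusAt R S p))⁻¹ := by
  have htsum : weight R (.ofReal p) (sub R S) =
      ENNReal.ofReal (∑' n, (tracesOfLength R S n).card * p ^ n) := by
    rw [weight_sub_eq_tsum, ENNReal.ofReal_tsum_of_nonneg (fun n => by positivity)
      (summable_card_tracesOfLength_mul_pow hp0 hp)]
    exact tsum_congr fun n => by
      rw [ENNReal.ofReal_mul (by positivity), ENNReal.ofReal_natCast, ENNReal.ofReal_pow hp0]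
  rw [htsum, ← ENNReal.ofReal_inv_of_pos (mobiusAt_pos hp0 hp),
    eq_inv_of_mul_eq_one_right (mobiusAt_mul_tsum hp0 hp)]

theorem weight_sub_ne_top {S : Set α} {p : ℝ} (hp0 : 0 ≤ p)
    (hp : ENNReal.ofReal p < smallestRoot R S) : weight R (.ofReal p) (sub R S) ≠ ∞ := by
  simp [weight_sub hp0 hp, mobiusAt_pos hp0 hp]

theorem isFiniteMeasure_weight {p : ℝ} (hp0 : 0 ≤ p)
    (hp : ENNReal.ofReal p < smallestRoot R Set.univ) : IsFiniteMeasure (weight R (.ofReal p)) :=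
  ⟨by simpa [sub_univ] using (weight_sub_ne_top hp0 hp).lt_top⟩

theorem multMeasure_eq_cond {S : Set α} {p : ℝ} (hp0 : 0 ≤ p)
    (hp : ENNReal.ofReal p < smallestRoot R S) :
    multMeasure R S p = (weight R (.ofReal p))[|sub R S] := by
  refine Measure.ext_of_singleton fun x => ?_
  rw [multMeasure, Measure.sum_apply _ .of_discrete, cond_apply .of_discrete, weight_sub hp0 hp,
    inv_inv]
  simp only [Measure.smul_apply, Measure.dirac_apply, smul_eq_mul]
  by_cases hx : x ∈ sub R S
  · have hne : ∀ y ≠ (⟨x, hx⟩ : sub R S), (y : TraceMonoid R) ∉ ({x} : Set _) :=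
      fun y hy h => hy (Subtype.ext h)
    rw [tsum_eq_single ⟨x, hx⟩ fun y hy => by rw [Set.indicator_of_notMem (hne y hy), mul_zero],
      Set.inter_eq_right.2 (Set.singleton_subset_iff.2 hx), weight_singleton,
      ENNReal.ofReal_mul (mobiusAt_pos hp0 hp).le, ENNReal.ofReal_pow hp0]
    simp
  · have hne : ∀ y : sub R S, (y : TraceMonoid R) ∉ ({x} : Set _) := fun y h => hx (h ▸ y.2)
    simp [Set.inter_singleton_eq_empty.2 hx, hne]

theorem condMeasure_eq_cond {S : Set α} {p : ℝ} (hp0 : 0 ≤ p)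
    (hp : ENNReal.ofReal p < smallestRoot R S) (T : Set α) :
    condMeasure R S p T = (weight R (.ofReal p))[|{x | x ∈ sub R S ∧ MaxIn R T x}] := by
  rw [condMeasure, multMeasure_eq_cond hp0 hp, cond_cond_eq_cond_inter' .of_discrete .of_discrete
    (weight_sub_ne_top hp0 hp)]
  rfl

end Weight

section FactorWeights

variable {α : Type*} [Countable α] {R : α → α → Prop} [Std.Symm R] [Std.Refl R] {a : α} {T : Set α}
  {q : ℝ≥0∞}

theorem cond_weight_pyr (hq : q ≠ 0) (hq' : q ≠ ∞) :
    (weight R q)[|pyr R a] =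
      ((weight R q)[|{v | v ∈ sub R {a}ᶜ ∧ MaxIn R (link R a) v}]).map (· * letter R a) := by
  rw [pyr_eq_image]
  refine cond_image_eq_map (mul_left_injective _).injOn (fun v _ => ?_) hq hq'
  rw [weight_singleton_mul, mul_comm, weight_singleton q (letter R a), length_letter, pow_one]

variable [IsFiniteMeasure (weight R q)]

theorem weight_maxIn_inter_occ (ha : a ∈ T) (k : ℕ) :
    weight R q ({x | MaxIn R T x} ∩ {x | occ R a x = k}) =
      weight R q {x | x ∈ sub R {a}ᶜ ∧ MaxIn R T x} * weight R q (pyr R a) ^ k := by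
  rw [← image_prod_factorSet ha, measure_image_eq_mul (injOn_prod_factorSet ha k)
    fun u _ => weight_singleton_prod_eq_one_mul_pi q u, one_mul, Measure.pi_pi,
    Fin.prod_univ_castSucc]
  simp [factorSet, mul_comm]

theorem weight_maxIn (ha : a ∈ T) : weight R q {x | MaxIn R T x} =
    weight R q {x | x ∈ sub R {a}ᶜ ∧ MaxIn R T x} * (1 - weight R q (pyr R a))⁻¹ := by
  have := tsum_measure_preimage_singleton (μ := (weight R q).restrict {x | MaxIn R T x})
    (f := occ R a) Set.countable_univ fun _ _ => .of_discrete
  rw [Set.preimage_univ, Measure.restrict_apply_univ, tsum_univ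
    fun n => (weight R q).restrict {x | MaxIn R T x} (occ R a ⁻¹' {n})] at this
  rw [← this, ← ENNReal.tsum_geometric, ← ENNReal.tsum_mul_left]
  refine tsum_congr fun k => ?_
  rw [Measure.restrict_apply .of_discrete, Set.inter_comm]
  exact weight_maxIn_inter_occ ha k

theorem weight_pyr_lt_one (hq : q ≠ 0) (a : α) : weight R q (pyr R a) < 1 := by
  have hsub : weight R q {x | x ∈ sub R {a}ᶜ ∧ MaxIn R Set.univ x} ≠ 0 :=
    weight_ne_zero hq ⟨1, one_mem _, maxIn_one _⟩
  have hinv : (1 - weight R q (pyr R a))⁻¹ ≠ ∞ := fun h => by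
    have := weight_maxIn (R := R) (q := q) (Set.mem_univ a)
    rw [h, ENNReal.mul_top hsub] at this
    exact measure_ne_top _ _ this
  exact tsub_pos_iff_lt.1 (pos_iff_ne_zero.2 (ENNReal.inv_ne_top.1 hinv))

theorem cond_weight_maxIn_occ (hq : q ≠ 0) (ha : a ∈ T) (k : ℕ) :
    (weight R q)[{x | occ R a x = k} | {x | MaxIn R T x}] =
      (1 - weight R q (pyr R a)) * weight R q (pyr R a) ^ k := by
  have hsub : weight R q {x | x ∈ sub R {a}ᶜ ∧ MaxIn R T x} ≠ 0 :=
    weight_ne_zero hq ⟨1, one_mem _, maxIn_one _⟩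
  rw [cond_apply .of_discrete, weight_maxIn_inter_occ ha, weight_maxIn ha,
    ENNReal.mul_inv (.inl hsub) (.inl (measure_ne_top _ _)), inv_inv, mul_mul_mul_comm, mul_comm,
    ENNReal.inv_mul_cancel hsub (measure_ne_top _ _), mul_one]

theorem cond_weight_maxIn_inter_occ (hq : q ≠ 0) (ha : a ∈ T) (k : ℕ) :
    (weight R q)[|{x | MaxIn R T x} ∩ {x | occ R a x = k}] =
      (Measure.pi fun i => (weight R q)[|factorSet R a T k i]).map
        fun u => (List.ofFn u).prod := by
  rw [← image_prod_factorSet ha, cond_image_eq_map (injOn_prod_factorSet ha k)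
    (fun u _ => weight_singleton_prod_eq_one_mul_pi q u) one_ne_zero ENNReal.one_ne_top,
    cond_pi_pi _ (fun i => weight_ne_zero hq (factorSet_nonempty a T k i))
      fun i => measure_ne_top _ _]

end FactorWeights

section Laws

variable {α : Type*} [Fintype α] {R : α → α → Prop} [Std.Symm R] [Std.Refl R] {a : α} {T : Set α}
  {p : ℝ}

theorem isProbabilityMeasure_multMeasure {S : Set α} (hp0 : 0 < p)
    (hp : ENNReal.ofReal p < smallestRoot R S) : IsProbabilityMeasure (multMeasure R S p) := by
  rw [multMeasure_eq_cond hp0.le hp]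
  exact cond_isProbabilityMeasure_of_finite
    (weight_ne_zero (ENNReal.ofReal_pos.2 hp0).ne' ⟨1, one_mem _⟩) (weight_sub_ne_top hp0.le hp)

theorem isProbabilityMeasure_condMeasure {S : Set α} (hp0 : 0 < p)
    (hp : ENNReal.ofReal p < smallestRoot R S) (T : Set α) :
    IsProbabilityMeasure (condMeasure R S p T) := by
  rw [condMeasure_eq_cond hp0.le hp]
  exact cond_isProbabilityMeasure_of_finite
    (weight_ne_zero (ENNReal.ofReal_pos.2 hp0).ne' ⟨1, one_mem _, maxIn_one T⟩)
    (measure_ne_top_of_subset (fun _ hx => hx.1) (weight_sub_ne_top hp0.le hp))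

theorem condMeasure_univ_right {S : Set α} (hp0 : 0 < p)
    (hp : ENNReal.ofReal p < smallestRoot R S) :
    condMeasure R S p Set.univ = multMeasure R S p := by
  have := isProbabilityMeasure_multMeasure hp0 hp
  simp [condMeasure, maxIn_iff]

variable (hp0 : 0 < p) (hp : ENNReal.ofReal p < smallestRoot R Set.univ)
include hp0 hp

theorem measureReal_weight_pyr (a : α) : (weight R (.ofReal p)).real (pyr R a) =
    1 - mobiusAt R Set.univ p / mobiusAt R {a}ᶜ p := by
  have := isFiniteMeasure_weight hp0.le hp
  have hp' := hp.trans_le (smallestRoot_anti (Set.subset_univ {a}ᶜ))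
  have hlt := weight_pyr_lt_one (R := R) (ENNReal.ofReal_pos.2 hp0).ne' a
  have htotal := weight_maxIn (R := R) (q := .ofReal p) (Set.mem_univ a)
  have huniv : {x : TraceMonoid R | MaxIn R Set.univ x} = sub R Set.univ := by
    simp [sub_univ, maxIn_iff]
  have hcompl : {x | x ∈ sub R {a}ᶜ ∧ MaxIn R Set.univ x} = sub R {a}ᶜ := by simp [maxIn_iff]
  rw [huniv, hcompl, weight_sub hp0.le hp, weight_sub hp0.le hp'] at htotal
  have hreal := congrArg ENNReal.toReal htotal
  rw [ENNReal.toReal_mul, ENNReal.toReal_inv, ENNReal.toReal_inv, ENNReal.toReal_inv,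
    ENNReal.toReal_sub_of_le hlt.le ENNReal.one_ne_top,
    ENNReal.toReal_ofReal (mobiusAt_pos hp0.le hp).le,
    ENNReal.toReal_ofReal (mobiusAt_pos hp0.le hp').le, ← mul_inv, inv_inj] at hreal
  rw [hreal, mul_div_cancel_left₀ _ (mobiusAt_pos hp0.le hp').ne', measureReal_def,
    ENNReal.toReal_one, sub_sub_cancel]

theorem measureReal_weight_pyr_mem_Ioo (a : α) :
    (weight R (.ofReal p)).real (pyr R a) ∈ Set.Ioo 0 1 := by
  have := isFiniteMeasure_weight hp0.le hp
  have hq := (ENNReal.ofReal_pos.2 hp0).ne'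
  refine ⟨ENNReal.toReal_pos (weight_ne_zero hq (pyr_nonempty a)) (measure_ne_top _ _), ?_⟩
  rw [measureReal_def, ← ENNReal.toReal_one]
  exact (ENNReal.toReal_lt_toReal (measure_ne_top _ _) ENNReal.one_ne_top).2
    (weight_pyr_lt_one hq a)

theorem condMeasure_univ_left (T : Set α) :
    condMeasure R Set.univ p T = (weight R (.ofReal p))[|{x | MaxIn R T x}] := by
  simp [condMeasure_eq_cond hp0.le hp, sub_univ]

theorem measureReal_condMeasure_occ (ha : a ∈ T) (k : ℕ) :
    (condMeasure R Set.univ p T).real {x | occ R a x = k} =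
      (1 - (weight R (.ofReal p)).real (pyr R a)) * (weight R (.ofReal p)).real (pyr R a) ^ k := by
  have := isFiniteMeasure_weight hp0.le hp
  have hq := (ENNReal.ofReal_pos.2 hp0).ne'
  rw [condMeasure_univ_left hp0 hp, measureReal_def, cond_weight_maxIn_occ hq ha,
    ENNReal.toReal_mul, ENNReal.toReal_pow,
    ENNReal.toReal_sub_of_le (weight_pyr_lt_one hq a).le ENNReal.one_ne_top, ENNReal.toReal_one,
    measureReal_def]

theorem measureReal_multMeasure_occ_pos (a : α) :
    (multMeasure R Set.univ p).real {x | 0 < occ R a x} =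
      (weight R (.ofReal p)).real (pyr R a) := by
  have := isProbabilityMeasure_multMeasure hp0 hp
  have hcompl : {x | 0 < occ R a x} = {x | occ R a x = 0}ᶜ := by
    ext x
    exact Nat.pos_iff_ne_zero
  rw [hcompl, probReal_compl_eq_one_sub .of_discrete, ← condMeasure_univ_right hp0 hp,
    measureReal_condMeasure_occ hp0 hp (Set.mem_univ a)]
  ring

end Laws

section FactorLaws

variable {α : Type*} [Fintype α] {R : α → α → Prop} {a : α} {T : Set α} {p : ℝ}

/-- The laws of the factors `u₀, …, u_k` of a random trace with `k` occurrences of `a` whose maximal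
letters are in `T`. -/
noncomputable def factorLaw (R : α → α → Prop) (a : α) (p : ℝ) (T : Set α) (k : ℕ) :
    Fin (k + 1) → Measure (TraceMonoid R) :=
  Fin.snoc (fun _ => (condMeasure R {a}ᶜ p (link R a)).map (· * letter R a))
    (condMeasure R {a}ᶜ p T)

theorem factorLaw_castSucc (a : α) (p : ℝ) (T : Set α) {k : ℕ} (i : Fin k) :
    factorLaw R a p T k i.castSucc = (condMeasure R {a}ᶜ p (link R a)).map (· * letter R a) :=
  Fin.snoc_castSucc ..

theorem factorLaw_last (a : α) (p : ℝ) (T : Set α) (k : ℕ) :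
    factorLaw R a p T k (Fin.last k) = condMeasure R {a}ᶜ p T :=
  Fin.snoc_last ..

variable [Std.Symm R] [Std.Refl R] (hp0 : 0 < p) (hp : ENNReal.ofReal p < smallestRoot R Set.univ)
include hp0 hp

theorem cond_weight_factorSet (a : α) (T : Set α) (k : ℕ) (i : Fin (k + 1)) :
    (weight R (.ofReal p))[|factorSet R a T k i] = factorLaw R a p T k i := by
  have hp' := hp.trans_le (smallestRoot_anti (Set.subset_univ {a}ᶜ))
  induction i using Fin.lastCases with
  | last => simp only [factorSet, factorLaw_last, Fin.snoc_last, condMeasure_eq_cond hp0.le hp']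
  | cast i =>
    simp only [factorSet, factorLaw_castSucc, Fin.snoc_castSucc, condMeasure_eq_cond hp0.le hp',
      cond_weight_pyr (ENNReal.ofReal_pos.2 hp0).ne' ENNReal.ofReal_ne_top]

theorem isProbabilityMeasure_factorLaw (a : α) (T : Set α) (k : ℕ) (i : Fin (k + 1)) :
    IsProbabilityMeasure (factorLaw R a p T k i) := by
  have := isFiniteMeasure_weight hp0.le hp
  rw [← cond_weight_factorSet hp0 hp]
  exact cond_isProbabilityMeasure_of_finite
    (weight_ne_zero (ENNReal.ofReal_pos.2 hp0).ne' (factorSet_nonempty a T k i))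
    (measure_ne_top _ _)

theorem ae_mem_factorSet (a : α) (T : Set α) (k : ℕ) :
    ∀ᵐ u ∂Measure.pi (factorLaw R a p T k), u ∈ Set.univ.pi (factorSet R a T k) := by
  have := isProbabilityMeasure_factorLaw hp0 hp a T k
  have hfactor : ∀ i, ∀ᵐ u ∂Measure.pi (factorLaw R a p T k), u i ∈ factorSet R a T k i :=
    fun i => Measure.tendsto_eval_ae_ae.eventually
      (cond_weight_factorSet hp0 hp a T k i ▸ ae_cond_mem .of_discrete)
  filter_upwards [ae_all_iff.2 hfactor] with u hu i _ using hu i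

theorem condMeasure_cond_occ (ha : a ∈ T) (k : ℕ) :
    (condMeasure R Set.univ p T)[|{x | occ R a x = k}] =
      (Measure.pi (factorLaw R a p T k)).map fun u => (List.ofFn u).prod := by
  have := isFiniteMeasure_weight hp0.le hp
  simp only [condMeasure_univ_left hp0 hp, cond_cond_eq_cond_inter .of_discrete .of_discrete,
    cond_weight_maxIn_inter_occ (ENNReal.ofReal_pos.2 hp0).ne' ha, cond_weight_factorSet hp0 hp]

variable {Ω : Type*} [MeasurableSpace Ω] {P : Measure Ω}

section Factorization

variable {ξ : Ω → TraceMonoid R} {U V : ℕ → Ω → TraceMonoid R} (ha : a ∈ T) (hξ : Measurable ξ)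
  (hlaw : HasLaw ξ (condMeasure R Set.univ p T) P)
  (hU : ∀ ω, IsPyrDecomp R a (ξ ω) (occ R a (ξ ω)) fun i => U i ω)
include ha hξ hlaw hU

theorem hasLaw_factors (k : ℕ) :
    HasLaw (fun ω (i : Fin (k + 1)) => U i ω) (Measure.pi (factorLaw R a p T k))
      P[|{ω | occ R a (ξ ω) = k}] := by
  have hocc : ∀ᵐ ω ∂P[|{ω | occ R a (ξ ω) = k}], occ R a (ξ ω) = k :=
    ae_cond_mem (hξ (.of_discrete (s := {x | occ R a x = k})))
  have hmax : ∀ᵐ ω ∂P[|{ω | occ R a (ξ ω) = k}], MaxIn R T (ξ ω) := by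
    refine cond_absolutelyContinuous ((hlaw.ae_iff (p := MaxIn R T) .of_discrete).2 ?_)
    rw [condMeasure_univ_left hp0 hp]
    exact ae_cond_mem .of_discrete
  refine hasLaw_of_hasLaw_comp_of_injOn (injOn_prod_factorSet ha k) (ae_mem_factorSet hp0 hp a T k)
    ?_ ?_
  · filter_upwards [hocc, hmax] with ω hk hω
    obtain rfl := hk
    rw [mem_pi_factorSet_iff ha, (hU ω).prod_eq]
    exact ⟨hU ω, hω⟩
  · rw [← condMeasure_cond_occ hp0 hp ha]
    refine (hasLaw_cond_preimage hξ hlaw .of_discrete).congr ?_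
    filter_upwards [hocc] with ω hk
    obtain rfl := hk
    exact (hU ω).prod_eq

theorem hasLaw_factor {k : ℕ} (i : Fin (k + 1)) :
    HasLaw (U i) (factorLaw R a p T k i) P[|{ω | occ R a (ξ ω) = k}] := by
  have := isProbabilityMeasure_factorLaw hp0 hp a T k
  exact (measurePreserving_eval _ i).hasLaw.comp (hasLaw_factors hp0 hp ha hξ hlaw hU k)

theorem iIndepFun_factors (k : ℕ) :
    iIndepFun (fun i : Fin (k + 1) => U i) P[|{ω | occ R a (ξ ω) = k}] := by
  have := isProbabilityMeasure_factorLaw hp0 hp a T k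
  have hfactors := hasLaw_factors hp0 hp ha hξ hlaw hU k
  have := hfactors.isProbabilityMeasure
  exact (iIndepFun_iff_hasLaw_pi_pi (hasLaw_factor hp0 hp ha hξ hlaw hU)).2 hfactors

theorem hasLaw_pyramid {i k : ℕ} (hi : i < k) :
    HasLaw (U i) ((condMeasure R {a}ᶜ p (link R a)).map (· * letter R a))
      P[|{ω | occ R a (ξ ω) = k}] :=
  factorLaw_castSucc (R := R) a p T ⟨i, hi⟩ ▸
    hasLaw_factor hp0 hp ha hξ hlaw hU (Fin.castSucc ⟨i, hi⟩)

theorem hasLaw_remainder (k : ℕ) :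
    HasLaw (U k) (condMeasure R {a}ᶜ p T) P[|{ω | occ R a (ξ ω) = k}] :=
  factorLaw_last (R := R) a p T k ▸ hasLaw_factor hp0 hp ha hξ hlaw hU (Fin.last k)

theorem hasLaw_of_pyramid_eq_mul_letter
    (hV : ∀ ω, ∀ i < occ R a (ξ ω), U i ω = V i ω * letter R a) {i k : ℕ} (hi : i < k) :
    HasLaw (V i) (condMeasure R {a}ᶜ p (link R a)) P[|{ω | occ R a (ξ ω) = k}] := by
  refine hasLaw_of_hasLaw_comp_of_injOn (f := (· * letter R a)) (s := Set.univ)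
    (mul_left_injective _).injOn (.of_forall fun _ => trivial) (.of_forall fun _ => trivial)
    ((hasLaw_pyramid hp0 hp ha hξ hlaw hU hi).congr ?_)
  filter_upwards [ae_cond_mem (hξ (.of_discrete (s := {x | occ R a x = k})))] with ω hk
  exact (hV ω i (hi.trans_eq hk.symm)).symm

end Factorization

theorem hasLaw_prod_mul (ha : a ∈ T) {k : ℕ} {V : Fin k → Ω → TraceMonoid R}
    {U : Ω → TraceMonoid R} (hind : iIndepFun (Fin.snoc (α := fun _ => Ω → TraceMonoid R) V U) P)
    (hU : HasLaw U (condMeasure R {a}ᶜ p T) P)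
    (hV : ∀ i, HasLaw (V i) (condMeasure R {a}ᶜ p (link R a)) P) :
    HasLaw (fun ω => (List.ofFn fun i => V i ω * letter R a).prod * U ω)
      ((condMeasure R Set.univ p T)[|{x | occ R a x = k}]) P := by
  have := isProbabilityMeasure_factorLaw hp0 hp a T k
  let f : Fin (k + 1) → TraceMonoid R → TraceMonoid R := Fin.snoc (fun _ => (· * letter R a)) id
  have hlaw : ∀ i, HasLaw (f i ∘ Fin.snoc (α := fun _ => Ω → TraceMonoid R) V U i)
      (factorLaw R a p T k i) P := fun i => by
    induction i using Fin.lastCases with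
    | last => simpa only [f, factorLaw_last, Fin.snoc_last, Function.id_comp] using hU
    | cast i =>
      simp only [f, factorLaw_castSucc, Fin.snoc_castSucc]
      exact HasLaw.comp ⟨Measurable.of_discrete.aemeasurable, rfl⟩ (hV i)
  rw [condMeasure_cond_occ hp0 hp ha]
  refine (HasLaw.comp ⟨Measurable.of_discrete.aemeasurable, rfl⟩
    ((hind.comp f fun _ => .of_discrete).hasLaw_pi hlaw)).congr (.of_forall fun ω => ?_)
  simp only [Function.comp_apply, List.ofFn_succ_last (n := k), List.prod_append]
  simp [f]

theorem hasLaw_prod_range_mul (ha : a ∈ T) [IsFiniteMeasure P] {K : Ω → ℕ}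
    {V : ℕ → Ω → TraceMonoid R} {U : Ω → TraceMonoid R} (hK : Measurable K)
    (hKlaw : ∀ k, P.real {ω | K ω = k} = (condMeasure R Set.univ p T).real {x | occ R a x = k})
    (hind : ∀ k, iIndepFun (Fin.snoc (α := fun _ => Ω → TraceMonoid R) (fun i : Fin k => V i) U)
      P[|{ω | K ω = k}])
    (hU : ∀ k, HasLaw U (condMeasure R {a}ᶜ p T) P[|{ω | K ω = k}])
    (hV : ∀ k, ∀ i < k, HasLaw (V i) (condMeasure R {a}ᶜ p (link R a)) P[|{ω | K ω = k}]) :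
    HasLaw (fun ω => ((List.range (K ω)).map fun i => V i ω * letter R a).prod * U ω)
      (condMeasure R Set.univ p T) P := by
  have := isProbabilityMeasure_condMeasure hp0 hp T
  refine hasLaw_of_hasLaw_cond_fiber hK (.of_discrete (f := occ R a))
    (fun k => (measureReal_eq_measureReal_iff).1 (hKlaw k)) fun k => ?_
  refine (hasLaw_prod_mul hp0 hp ha (hind k) (hU k) fun i => hV k i i.2).congr ?_
  filter_upwards [ae_cond_mem (hK (measurableSet_singleton k))] with ω hk
  obtain rfl : K ω = k := hk
  rw [List.ofFn_eq_map, ← List.map_coe_finRange_eq_range, List.map_map]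
  rfl

end FactorLaws

end TraceMonoid

open TraceMonoid in
theorem proposition2 {α : Type*} [Fintype α] (R : α → α → Prop)
    (hrefl : ∀ a, R a a) (hsymm : ∀ a b, R a b → R b a)
    (T : Set α) (a : α) (ha : a ∈ T)
    (p : ℝ) (hp0 : 0 < p) (hp : ENNReal.ofReal p < smallestRoot R Set.univ)
    (r : ℝ) (hr : r = 1 - mobiusAt R Set.univ p / mobiusAt R {a}ᶜ p) :
    -- the parameters are admissible
    ENNReal.ofReal p < smallestRoot R {a}ᶜ ∧
    IsProbabilityMeasure (multMeasure R {a}ᶜ p) ∧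
    r ∈ Set.Ioo 0 1 ∧
    r = (multMeasure R Set.univ p).real {x | 0 < occ R a x} ∧
    -- the decomposition into pyramidal factors and a remainder is well defined
    (∀ x : TraceMonoid R, ∃! u, IsPyrDecomp R a x (occ R a x) u) ∧
    (∀ u ∈ pyr R a, ∃! v, v ∈ sub R {a}ᶜ ∧ u = v * letter R a) ∧
    -- the laws of the decomposition of a random trace
    (∀ (Ω : Type*) [MeasurableSpace Ω] (P : Measure Ω) [IsProbabilityMeasure P]
      (ξ : Ω → TraceMonoid R) (K : Ω → ℕ) (U V : ℕ → Ω → TraceMonoid R),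
      Measurable ξ → HasLaw ξ (condMeasure R Set.univ p T) P →
      (∀ ω, K ω = occ R a (ξ ω)) →
      (∀ ω, IsPyrDecomp R a (ξ ω) (K ω) (fun i => U i ω)) →
      (∀ ω, ∀ i < K ω, V i ω ∈ sub R {a}ᶜ ∧ U i ω = V i ω * letter R a) →
      (∀ k : ℕ, P.real {ω | K ω = k} = (1 - r) * r ^ k) ∧
      ∀ k : ℕ,
        iIndepFun (fun i : Fin (k + 1) => U i) P[|{ω | K ω = k}] ∧
        (∀ i < k, ∀ j < k,
          IdentDistrib (U i) (U j) P[|{ω | K ω = k}] P[|{ω | K ω = k}]) ∧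
        (∀ i < k, HasLaw (V i) (condMeasure R {a}ᶜ p (link R a)) P[|{ω | K ω = k}]) ∧
        HasLaw (U k) (condMeasure R {a}ᶜ p T) P[|{ω | K ω = k}]) ∧
    -- the reconstruction of a random trace
    (∀ (Ω : Type*) [MeasurableSpace Ω] (P : Measure Ω) [IsProbabilityMeasure P]
      (K : Ω → ℕ) (V : ℕ → Ω → TraceMonoid R) (U : Ω → TraceMonoid R),
      Measurable K →
      (∀ k : ℕ, P.real {ω | K ω = k} = (1 - r) * r ^ k) →
      (∀ k : ℕ,
        iIndepFun (Fin.snoc (α := fun _ => Ω → TraceMonoid R) (fun i : Fin k => V i) U)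
          P[|{ω | K ω = k}] ∧
        HasLaw U (condMeasure R {a}ᶜ p T) P[|{ω | K ω = k}] ∧
        ∀ i < k, HasLaw (V i) (condMeasure R {a}ᶜ p (link R a)) P[|{ω | K ω = k}]) →
      HasLaw
        (fun ω => ((List.range (K ω)).map fun i => V i ω * letter R a).prod * U ω)
        (condMeasure R Set.univ p T) P) := by
  have : Std.Refl R := ⟨hrefl⟩
  have : Std.Symm R := ⟨hsymm⟩
  have hp' := hp.trans_le (smallestRoot_anti (Set.subset_univ {a}ᶜ))
  obtain rfl : r = (weight R (.ofReal p)).real (pyr R a) :=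
    hr.trans (measureReal_weight_pyr hp0 hp a).symm
  refine ⟨hp', isProbabilityMeasure_multMeasure hp0 hp', measureReal_weight_pyr_mem_Ioo hp0 hp a,
    (measureReal_multMeasure_occ_pos hp0 hp a).symm, existsUnique_isPyrDecomp a,
    fun _ => existsUnique_eq_mul_letter, ?_, ?_⟩
  · intro Ω _ P _ ξ K U V hξ hlaw hK hU hV
    obtain rfl : K = fun ω => occ R a (ξ ω) := funext hK
    refine ⟨fun k => (hlaw.measureReal_eq .of_discrete).trans
        (measureReal_condMeasure_occ hp0 hp ha k),
      fun k => ⟨iIndepFun_factors hp0 hp ha hξ hlaw hU k, fun i hi j hj => ?_,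
        fun i hi => hasLaw_of_pyramid_eq_mul_letter hp0 hp ha hξ hlaw hU
          (fun ω i hi => (hV ω i hi).2) hi,
        hasLaw_remainder hp0 hp ha hξ hlaw hU k⟩⟩
    exact (hasLaw_pyramid hp0 hp ha hξ hlaw hU hi).identDistrib
      (hasLaw_pyramid hp0 hp ha hξ hlaw hU hj)
  · intro Ω _ P _ K V U hK hKlaw h
    exact hasLaw_prod_range_mul hp0 hp ha hK
      (fun k => (hKlaw k).trans (measureReal_condMeasure_occ hp0 hp ha k).symm)
      (fun k => (h k).1) (fun k => (h k).2.1) fun k => (h k).2.2
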